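/- \textbf{Theorem (Good codes from low-depth circuits).} There are constants $\alpha,\beta,c>0$ and $n_0\in\mathbb N$ such that for every integer $n\ge n_0$ there exist a stabilizer code on $n$ qubits and a Clifford circuit on $n$ qubits with the following properties. \begin{enumerate} \item The code encodes $k=\lfloor \beta n\rfloor$ qubits, i.e.\ its code space has dimension $2^{k}$. \item The minimum distance $d$ of the code satisfies $d\ge \alpha n$. \item The code is non-degenerate: every non-identity element of its stabilizer has weight at least $d$. \item The circuit is an encoding circuit for the code: if $U$ is the unitary that it implements, the code space is $\{U(|\varphi\rangle\otimes|0\rangle^{\otimes(n-k)}) : |\varphi\rangle\in(\mathbb C^2)^{\otimes k}\}$. \item The circuit has depth at most $c\,(\log n)^3$. \end{enumerate} Here a stabilizer code on $n$ qubits is given by an abelian subgroup $S$ of the $n$-qubit Pauli group with $-\mathbb 1\notin S$ (its stabilizer), and its code space is the joint $+1$-eigenspace of $S$. The weight of a Pauli operator is the number of qubits on which it acts non-trivially, and the minimum distance is the least weight of a Pauli operator that commutes with all of $S$ and is not a scalar multiple of an element of $S$. A Clifford circuit of depth $D$ is a sequence of $D$ layers, each made of two-qubit Clifford gates (unitaries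 normalizing the two-qubit Pauli group), on arbitrary pairs of qubits, such that no two gates of a layer share a qubit. -/

import Mathlib

/-- Computational basis labels of an `n`-qubit register. -/
abbrev QubitBasis (n : ℕ) : Type := Fin n → Fin 2

/-- Operators on `n` qubits, as matrices in the computational basis. -/
abbrev QubitOp (n : ℕ) : Type := Matrix (QubitBasis n) (QubitBasis n) ℂ

/-- The group of unitary operators on `n` qubits. -/
abbrev QubitUnitary (n : ℕ) : Type := Matrix.unitaryGroup (QubitBasis n) ℂ

/-- The single-qubit matrices `σ₀ = 1`, `σ₁ = X`, `σ₂ = Y`, `σ₃ = Z`. -/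
def pauliMatrix : Fin 4 → Matrix (Fin 2) (Fin 2) ℂ :=
  ![1, !![0, 1; 1, 0], !![0, -Complex.I; Complex.I, 0], !![1, 0; 0, -1]]

/-- The Pauli string `σ_ν = σ_{ν 0} ⊗ ⋯ ⊗ σ_{ν (n-1)}`. -/
def pauliString {n : ℕ} (ν : Fin n → Fin 4) : QubitOp n :=
  Matrix.of fun x y => ∏ i, pauliMatrix (ν i) (x i) (y i)

/-- The weight of a Pauli string: the number of qubits on which it acts nontrivially. -/
def pauliWeight {n : ℕ} (ν : Fin n → Fin 4) : ℕ :=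
  (Finset.univ.filter fun i => ν i ≠ 0).card

/-- Membership in the `n`-qubit Pauli group `{±1, ±i} · {σ_ν}`. -/
def IsPauli {n : ℕ} (M : QubitOp n) : Prop :=
  ∃ c : ℂ, (c = 1 ∨ c = -1 ∨ c = Complex.I ∨ c = -Complex.I) ∧
    ∃ ν : Fin n → Fin 4, M = c • pauliString ν

/-- Clifford unitaries: those that conjugate every Pauli string into the Pauli group. -/
def IsClifford {n : ℕ} (U : QubitUnitary n) : Prop :=
  ∀ ν : Fin n → Fin 4,
    IsPauli ((U : QubitOp n) * pauliString ν * (U : QubitOp n).conjTranspose)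

/-- A stabilizer code on `n` qubits, given by its stabilizer: an abelian subgroup of the Pauli
group that does not contain `-1`. -/
structure StabilizerCode (n : ℕ) where
  stabilizer : Subgroup (QubitUnitary n)
  isPauli : ∀ g ∈ stabilizer, IsPauli (g : QubitOp n)
  comm : ∀ g ∈ stabilizer, ∀ h ∈ stabilizer, g * h = h * g
  neg_one_notMem : ∀ g ∈ stabilizer, (g : QubitOp n) ≠ -1

namespace StabilizerCode

/-- The code space: the joint `+1` eigenspace of the stabilizer. -/
def codeSpace {n : ℕ} (C : StabilizerCode n) : Submodule ℂ (QubitBasis n → ℂ) where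
  carrier := {v | ∀ g ∈ C.stabilizer, (g : QubitOp n).mulVec v = v}
  add_mem' := by
    intro v w hv hw g hg
    rw [Matrix.mulVec_add, hv g hg, hw g hg]
  zero_mem' := by
    intro g _
    exact Matrix.mulVec_zero _
  smul_mem' := by
    intro c v hv g hg
    rw [Matrix.mulVec_smul, hv g hg]

/-- The code encodes `k` qubits: its code space has dimension `2 ^ k`. -/
def EncodesQubits {n : ℕ} (C : StabilizerCode n) (k : ℕ) : Prop :=
  Module.finrank ℂ C.codeSpace = 2 ^ k

/-- `σ_ν` belongs to the stabilizer, up to a scalar factor. -/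
def InStabilizer {n : ℕ} (C : StabilizerCode n) (ν : Fin n → Fin 4) : Prop :=
  ∃ g ∈ C.stabilizer, ∃ c : ℂ, (g : QubitOp n) = c • pauliString ν

/-- `σ_ν` belongs to the normalizer of the stabilizer in the Pauli group, which is its
centralizer. -/
def InNormalizer {n : ℕ} (C : StabilizerCode n) (ν : Fin n → Fin 4) : Prop :=
  ∀ g ∈ C.stabilizer, (g : QubitOp n) * pauliString ν = pauliString ν * (g : QubitOp n)

/-- The minimum distance: the least weight of a Pauli string that lies in the normalizer of the
stabilizer but, up to a scalar, not in the stabilizer. (Such a string exists as soon as the code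
space has dimension at least two; otherwise the value here is `0`.) -/
noncomputable def minDistance {n : ℕ} (C : StabilizerCode n) : ℕ :=
  sInf {w | ∃ ν : Fin n → Fin 4, C.InNormalizer ν ∧ ¬ C.InStabilizer ν ∧ pauliWeight ν = w}

/-- A code is non-degenerate if no stabilizer element other than the identity has weight less
than the minimum distance. -/
def IsNondegenerate {n : ℕ} (C : StabilizerCode n) : Prop :=
  ∀ ν : Fin n → Fin 4, ν ≠ 0 → C.InStabilizer ν → C.minDistance ≤ pauliWeight ν

end StabilizerCode

/-- A two-qubit Clifford gate applied to the distinct qubits `fst` and `snd` among `n`. -/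
structure CliffordGate (n : ℕ) where
  fst : Fin n
  snd : Fin n
  fst_ne_snd : fst ≠ snd
  gate : QubitUnitary 2
  isClifford : IsClifford gate

namespace CliffordGate

/-- The action of the gate on `n` qubits: `gate` on the qubits `fst`, `snd`, tensored with the
identity on all the other qubits. -/
def toOp {n : ℕ} (G : CliffordGate n) : QubitOp n :=
  Matrix.of fun x y =>
    if ∀ l, l ≠ G.fst → l ≠ G.snd → x l = y l then
      (G.gate : QubitOp 2) ![x G.fst, x G.snd] ![y G.fst, y G.snd]
    else 0

/-- Two gates act on disjoint pairs of qubits. -/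
def Disjoint {n : ℕ} (G H : CliffordGate n) : Prop :=
  G.fst ≠ H.fst ∧ G.fst ≠ H.snd ∧ G.snd ≠ H.fst ∧ G.snd ≠ H.snd

end CliffordGate

/-- A Clifford circuit on `n` qubits: a sequence of layers, in temporal order, each consisting of
two-qubit Clifford gates no two of which act on a common qubit. -/
structure CliffordCircuit (n : ℕ) where
  layers : List (List (CliffordGate n))
  disjoint : ∀ L ∈ layers, L.Pairwise CliffordGate.Disjoint

namespace CliffordCircuit

/-- The depth of a circuit is its number of layers. -/
def depth {n : ℕ} (E : CliffordCircuit n) : ℕ := E.layers.length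

/-- The operator implemented by a circuit; the head of the list of layers acts first. -/
def toOp {n : ℕ} (E : CliffordCircuit n) : QubitOp n :=
  E.layers.foldl (fun M L => (L.map CliffordGate.toOp).prod * M) 1

end CliffordCircuit

/-- The `n`-qubit vector `φ ⊗ |0⟩^{⊗ (n - k)}`, where `φ` is a `k`-qubit vector. -/
def withAncillas {k n : ℕ} (h : k ≤ n) (φ : QubitBasis k → ℂ) : QubitBasis n → ℂ :=
  fun x => if ∀ i : Fin n, k ≤ (i : ℕ) → x i = 0 then φ (fun j => x (Fin.castLE h j)) else 0

/-- `E` is an encoding circuit for `C` with `k` input qubits: the codewords are precisely the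
vectors `E (φ ⊗ |0⟩^{⊗ (n - k)})`, for `φ` a vector of `k` qubits. -/
def CliffordCircuit.IsEncoder {n : ℕ} (E : CliffordCircuit n) (C : StabilizerCode n) (k : ℕ) :
    Prop :=
  ∃ h : k ≤ n, (C.codeSpace : Set (QubitBasis n → ℂ)) =
    Set.range fun φ : QubitBasis k → ℂ => E.toOp.mulVec (withAncillas h φ)

/-!
A circuit of two-qubit Clifford gates acts on Pauli strings modulo phases as a linear map `f` of
`(ZMod 2 × ZMod 2) ^ n`. The code that it prepares from `k` input qubits and `n - k` ancillas in the
state `|0⟩` has the stabilizer `f S` and the normalizer `f N` modulo phases, where `S` and `N` are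
the stabilizer and the normalizer belonging to the ancillas (`ancillaStabilizer`,
`ancillaNormalizer`). So it suffices to find a shallow circuit for which `f` takes every nonzero
vector of `N` to a vector of linear weight (`exists_code_of_realizable`). Non-degeneracy does not
follow from this alone; but `f N` always contains a nonzero vector supported on the first `w` qubits
if `2 w > n - k`, hence it is enough that the nonzero vectors of `f S` have weight more than such a
`w`. For the rate `15 / 16` one can take `w = n / 32 + 2`.

The gates are transvections `v ↦ v + ⟨v, w⟩ w`, implemented by `exp (i π σ_w / 4)`. A transvection
on `m` qubits is a product of `2 m - 1` two-qubit ones (`realizable_parTransvection`). The qubits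
are divided into `2 ^ a` blocks of `O(log n)` qubits. The map `f` is composed of three parts.

* A mixing of every block by a product of `O(log n)` random transvections (`blockMix`), of depth
  `O(log n ^ 2)`. It takes a given nonzero vector of a block to a nearly uniform one
  (`card_blockMix_le`).
* A butterfly network of `a` levels, which couples sites of two qubits of the blocks along the edges
  of a cube of dimension `a` (`butterfly`). Its elementary coupling has only entries that are
  invertible, which yields an uncertainty principle as for the Fourier transform: the vectors with
  block support in `T` that are mapped to vectors with block support in `R` form a space of
  dimension at most `|T| |R| / 2 ^ a` times that of a site (`card_concentrated_pow_le`). After the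
  first mixing, a union bound over block supports shows that, for some choice of the random strings,
  every nonzero vector of `N` is taken to a vector that is nonzero in more than `1 / 64` of the
  blocks, and every nonzero vector of `S` to one that is nonzero in more than half of the blocks
  (`card_bad_blockSupport_le`). The union bound must not refer to `R`, of which there are too many:
  the condition that the transform vanishes outside `R` is replaced by its vanishing at `4 |T|`
  points (`exists_vanishing_eq_concentrated`).
* A second mixing of the blocks. In a linear space all of whose nonzero vectors are nonzero in more
  than `s` blocks, a vector with block support `Y` is determined by its restriction to `|Y| - s` of
  the blocks, so that there are few of them compared with the number of vectors over which the
  mixing spreads each of them. A union bound over the vectors of low weight then gives linear weight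
  (`card_bad_vecWeight_le`).

The total depth is `O(log n ^ 2)`.
-/

/-! ### Pauli vectors -/

/-- Pauli strings modulo phases, in symplectic form: the `i`-th entry `(x, z)` stands for
`X ^ x * Z ^ z` on qubit `i`. -/
abbrev PauliVec (n : ℕ) : Type := Fin n → ZMod 2 × ZMod 2

/-- The index of the single-qubit matrix with symplectic coordinates `p`. -/
def pauliIndex : ZMod 2 × ZMod 2 ≃ Fin 4 where
  toFun p := (![![0, 3], ![1, 2]] : Fin 2 → Fin 2 → Fin 4) p.1 p.2
  invFun := ![(0, 0), (1, 0), (1, 1), (0, 1)]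
  left_inv := by decide
  right_inv := by decide

/-- The symplectic form on one qubit. -/
def symp (p q : ZMod 2 × ZMod 2) : ZMod 2 := p.1 * q.2 + p.2 * q.1

/-- The sign `(-1) ^ s`. -/
noncomputable def bitSign (s : ZMod 2) : ℂ := if s = 0 then 1 else -1

theorem eq_zero_or_one (s : ZMod 2) : s = 0 ∨ s = 1 := by
  revert s; decide

theorem bitSign_add (s t : ZMod 2) : bitSign (s + t) = bitSign s * bitSign t := by
  have h : (1 : ZMod 2) + 1 = 0 := by decide
  rcases eq_zero_or_one s with rfl | rfl <;> rcases eq_zero_or_one t with rfl | rfl <;>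
    simp [bitSign, h]

theorem bitSign_zero : bitSign 0 = 1 := by simp [bitSign]

theorem bitSign_sum {ι : Type*} (s : Finset ι) (f : ι → ZMod 2) :
    bitSign (∑ i ∈ s, f i) = ∏ i ∈ s, bitSign (f i) := by
  classical
  induction s using Finset.induction_on with
  | empty => simp [bitSign]
  | insert a s ha ih => rw [Finset.sum_insert ha, Finset.prod_insert ha, bitSign_add, ih]

theorem symp_add_left (p q r : ZMod 2 × ZMod 2) : symp (p + q) r = symp p r + symp q r := by
  simp only [symp, Prod.fst_add, Prod.snd_add]; ring

theorem symp_add_right (p q r : ZMod 2 × ZMod 2) : symp p (q + r) = symp p q + symp p r := by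
  simp only [symp, Prod.fst_add, Prod.snd_add]; ring

theorem symp_zero_right (p : ZMod 2 × ZMod 2) : symp p 0 = 0 := by simp [symp]

theorem symp_zero_left (p : ZMod 2 × ZMod 2) : symp 0 p = 0 := by simp [symp]

theorem symp_self (p : ZMod 2 × ZMod 2) : symp p p = 0 := by
  revert p; decide

theorem symp_comm (p q : ZMod 2 × ZMod 2) : symp p q = symp q p := by
  simp only [symp]; ring

/-- The symplectic form on `n` qubits; two Pauli strings commute exactly if it vanishes. -/
def sympVec {n : ℕ} (v w : PauliVec n) : ZMod 2 := ∑ i, symp (v i) (w i)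

theorem pauliIndex_add (p q : ZMod 2 × ZMod 2) : pauliIndex (p + q) =
    (![![0, 1, 2, 3], ![1, 0, 3, 2], ![2, 3, 0, 1], ![3, 2, 1, 0]] : Fin 4 → Fin 4 → Fin 4)
      (pauliIndex p) (pauliIndex q) := by
  revert p q; decide

theorem symp_eq_ite (p q : ZMod 2 × ZMod 2) : symp p q =
    if pauliIndex p = 0 ∨ pauliIndex q = 0 ∨ pauliIndex p = pauliIndex q then 0 else 1 := by
  revert p q; decide

theorem exists_phase_pauliMatrix_mul (p q : ZMod 2 × ZMod 2) : ∃ c : ℂ, c ^ 4 = 1 ∧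
    pauliMatrix (pauliIndex p) * pauliMatrix (pauliIndex q) =
      c • pauliMatrix (pauliIndex (p + q)) := by
  have hI' : (-Complex.I) ^ 4 = 1 := by rw [Even.neg_pow (by decide), Complex.I_pow_four]
  rw [pauliIndex_add]
  generalize pauliIndex p = ν
  generalize pauliIndex q = μ
  fin_cases ν <;> fin_cases μ <;>
  first
  | (refine ⟨1, by norm_num, ?_⟩
     ext i j
     fin_cases i <;> fin_cases j <;>
       simp [pauliMatrix, Matrix.mul_apply, Fin.sum_univ_two]; done)
  | (refine ⟨Complex.I, Complex.I_pow_four, ?_⟩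
     ext i j
     fin_cases i <;> fin_cases j <;>
       simp [pauliMatrix, Matrix.mul_apply, Fin.sum_univ_two]; done)
  | (refine ⟨-Complex.I, hI', ?_⟩
     ext i j
     fin_cases i <;> fin_cases j <;>
       simp [pauliMatrix, Matrix.mul_apply, Fin.sum_univ_two])

theorem pauliMatrix_mul_comm (p q : ZMod 2 × ZMod 2) :
    pauliMatrix (pauliIndex p) * pauliMatrix (pauliIndex q) =
      bitSign (symp p q) • (pauliMatrix (pauliIndex q) * pauliMatrix (pauliIndex p)) := by
  rw [symp_eq_ite]
  generalize pauliIndex p = ν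
  generalize pauliIndex q = μ
  fin_cases ν <;> fin_cases μ <;>
    ext i j <;> fin_cases i <;> fin_cases j <;>
      simp [pauliMatrix, Matrix.mul_apply, Fin.sum_univ_two, bitSign]

theorem pauliMatrix_mul_self (ν : Fin 4) : pauliMatrix ν * pauliMatrix ν = 1 := by
  fin_cases ν <;> ext i j <;> fin_cases i <;> fin_cases j <;>
    simp [pauliMatrix, Matrix.mul_apply, Fin.sum_univ_two]

theorem pauliMatrix_conjTranspose (ν : Fin 4) : (pauliMatrix ν).conjTranspose = pauliMatrix ν := by
  fin_cases ν <;> ext i j <;> fin_cases i <;> fin_cases j <;>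
    simp [pauliMatrix, Matrix.conjTranspose_apply]

/-- The operator with entries `∏ i, M i (x i) (y i)`, the tensor product of the matrices `M i`. -/
def tensorOp {n : ℕ} (M : Fin n → Matrix (Fin 2) (Fin 2) ℂ) : QubitOp n :=
  Matrix.of fun x y => ∏ i, M i (x i) (y i)

theorem tensorOp_mul {n : ℕ} (M M' : Fin n → Matrix (Fin 2) (Fin 2) ℂ) :
    tensorOp M * tensorOp M' = tensorOp fun i => M i * M' i := by
  ext x y
  simp only [tensorOp, Matrix.mul_apply, Matrix.of_apply, ← Finset.prod_mul_distrib]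
  rw [Finset.prod_univ_sum]
  simp [Fintype.piFinset_univ]

theorem tensorOp_smul {n : ℕ} (c : Fin n → ℂ) (M : Fin n → Matrix (Fin 2) (Fin 2) ℂ) :
    tensorOp (fun i => c i • M i) = (∏ i, c i) • tensorOp M := by
  ext x y
  simp [tensorOp, Finset.prod_mul_distrib]

theorem tensorOp_one {n : ℕ} : tensorOp (fun _ : Fin n => 1) = 1 := by
  ext x y
  simp only [tensorOp, Matrix.of_apply, Matrix.one_apply]
  by_cases h : x = y
  · simp [h]
  · rw [if_neg h]
    obtain ⟨i, hi⟩ := Function.ne_iff.mp h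
    exact Finset.prod_eq_zero (Finset.mem_univ i) (if_neg hi)

/-- The Pauli string with symplectic coordinates `v`. -/
def sigma {n : ℕ} (v : PauliVec n) : QubitOp n := pauliString fun i => pauliIndex (v i)

theorem sigma_eq_tensorOp {n : ℕ} (v : PauliVec n) :
    sigma v = tensorOp fun i => pauliMatrix (pauliIndex (v i)) := rfl

theorem pauliString_eq_sigma {n : ℕ} (ν : Fin n → Fin 4) :
    pauliString ν = sigma fun i => pauliIndex.symm (ν i) := by
  simp [sigma]

theorem sigma_zero {n : ℕ} : sigma (0 : PauliVec n) = 1 := by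
  rw [sigma_eq_tensorOp, ← tensorOp_one]
  rfl

theorem exists_phase_sigma_mul {n : ℕ} (v w : PauliVec n) :
    ∃ c : ℂ, c ^ 4 = 1 ∧ sigma v * sigma w = c • sigma (v + w) := by
  choose c hc h using fun i => exists_phase_pauliMatrix_mul (v i) (w i)
  refine ⟨∏ i, c i, ?_, ?_⟩
  · rw [← Finset.prod_pow]; simp [hc]
  · rw [sigma_eq_tensorOp, sigma_eq_tensorOp, tensorOp_mul, sigma_eq_tensorOp, ← tensorOp_smul]
    congr 1
    funext i
    exact h i

theorem sigma_mul_comm {n : ℕ} (v w : PauliVec n) :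
    sigma v * sigma w = bitSign (sympVec v w) • (sigma w * sigma v) := by
  rw [sigma_eq_tensorOp, sigma_eq_tensorOp, tensorOp_mul, tensorOp_mul, sympVec, bitSign_sum,
    ← tensorOp_smul]
  congr 1
  funext i
  exact pauliMatrix_mul_comm _ _

theorem sigma_mul_self {n : ℕ} (v : PauliVec n) : sigma v * sigma v = 1 := by
  rw [sigma_eq_tensorOp, tensorOp_mul, ← tensorOp_one]
  simp [pauliMatrix_mul_self]

theorem sigma_conjTranspose {n : ℕ} (v : PauliVec n) : (sigma v).conjTranspose = sigma v := by
  ext x y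
  simp only [sigma, pauliString, Matrix.conjTranspose_apply, Matrix.of_apply, star_prod]
  refine Finset.prod_congr rfl fun i _ => ?_
  rw [← Matrix.conjTranspose_apply, pauliMatrix_conjTranspose]

theorem sigma_ne_zero {n : ℕ} (v : PauliVec n) : sigma v ≠ 0 := by
  intro h
  have := sigma_mul_self v
  rw [h, mul_zero] at this
  exact zero_ne_one this

theorem eq_of_pow_four_eq_one {c : ℂ} (h : c ^ 4 = 1) :
    c = 1 ∨ c = -1 ∨ c = Complex.I ∨ c = -Complex.I := by
  have h1 : (c - 1) * ((c + 1) * ((c - Complex.I) * (c + Complex.I))) = 0 := by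
    linear_combination h - (c ^ 2 - 1) * Complex.I_sq
  rcases mul_eq_zero.mp h1 with h | h
  · exact Or.inl (sub_eq_zero.mp h)
  rcases mul_eq_zero.mp h with h | h
  · exact Or.inr (Or.inl (eq_neg_of_add_eq_zero_left h))
  rcases mul_eq_zero.mp h with h | h
  · exact Or.inr (Or.inr (Or.inl (sub_eq_zero.mp h)))
  · exact Or.inr (Or.inr (Or.inr (eq_neg_of_add_eq_zero_left h)))

/-- Pauli strings with different coordinates are linearly independent. -/
theorem eq_of_sigma_eq_smul {n : ℕ} {v w : PauliVec n} {c : ℂ} (h : sigma v = c • sigma w) :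
    v = w := by
  by_contra hne
  obtain ⟨i, hi⟩ := Function.ne_iff.mp hne
  have key : ∀ p q : ZMod 2 × ZMod 2, p ≠ q → ∃ r, symp p r = 0 ∧ symp q r = 1 ∨
      symp p r = 1 ∧ symp q r = 0 := by decide
  obtain ⟨r, hr⟩ := key _ _ hi
  let u : PauliVec n := Function.update 0 i r
  have hu : ∀ v : PauliVec n, sympVec v u = symp (v i) r := by
    intro v
    rw [sympVec, Finset.sum_eq_single i]
    · simp [u]
    · intro j _ hj
      simp [u, hj, symp]
    · simp
  have h1 := sigma_mul_comm v u
  have h2 := sigma_mul_comm w u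
  have hinj : ∀ s : ℂ, s = -1 → sigma v * sigma u = s • (sigma v * sigma u) → False := by
    intro s hs hh
    have h3 : sigma v * sigma u ≠ 0 := by
      intro h0
      have : sigma v * sigma u * sigma u = 0 := by rw [h0, zero_mul]
      rw [mul_assoc, sigma_mul_self, mul_one] at this
      exact sigma_ne_zero _ this
    have h4 : (2 : ℂ) • (sigma v * sigma u) = 0 := by
      rw [two_smul]; nth_rewrite 1 [hh]; rw [hs]; simp
    exact h3 ((smul_eq_zero.mp h4).resolve_left two_ne_zero)
  have h5 : sigma v * sigma u = bitSign (sympVec w u) • (sigma u * sigma v) := by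
    rw [h, smul_mul_assoc, h2, Matrix.mul_smul, smul_comm]
  have h6 : sigma v * sigma u = (bitSign (sympVec v u) * bitSign (sympVec w u)) •
      (sigma v * sigma u) := by
    have h7 := sigma_mul_comm u v
    have hs : sympVec u v = sympVec v u := by simp only [sympVec, symp_comm]
    rw [mul_comm, mul_smul]
    nth_rewrite 1 [h5]
    rw [h7, hs]
  refine hinj _ ?_ h6
  rw [hu, hu]
  rcases hr with ⟨a, b⟩ | ⟨a, b⟩ <;> rw [a, b] <;> simp [bitSign]

/-! ### Operators acting on Pauli strings -/

/-- `U` is a unitary that conjugates `σ_v` to `σ_{f v}` up to a fourth root of unity, for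
every `v`. -/
def Implements {n : ℕ} (U : QubitOp n) (f : PauliVec n → PauliVec n) : Prop :=
  U ∈ Matrix.unitaryGroup (QubitBasis n) ℂ ∧
    ∀ v, ∃ c : ℂ, c ^ 4 = 1 ∧ U * sigma v = c • (sigma (f v) * U)

theorem Implements.one {n : ℕ} : Implements (1 : QubitOp n) id :=
  ⟨one_mem _, fun v => ⟨1, by norm_num, by simp⟩⟩

theorem Implements.mul {n : ℕ} {U V : QubitOp n} {f g : PauliVec n → PauliVec n}
    (hU : Implements U f) (hV : Implements V g) : Implements (V * U) (g ∘ f) := by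
  refine ⟨mul_mem hV.1 hU.1, fun v => ?_⟩
  obtain ⟨c, hc, h⟩ := hU.2 v
  obtain ⟨c', hc', h'⟩ := hV.2 (f v)
  refine ⟨c * c', by rw [mul_pow, hc, hc', one_mul], ?_⟩
  rw [mul_assoc, h, Matrix.mul_smul, ← mul_assoc, h', smul_mul_assoc, smul_smul, mul_assoc]
  rfl

theorem Implements.conj {n : ℕ} {U : QubitOp n} {f : PauliVec n → PauliVec n}
    (hU : Implements U f) (v : PauliVec n) :
    ∃ c : ℂ, c ^ 4 = 1 ∧ U * sigma v * U.conjTranspose = c • sigma (f v) := by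
  obtain ⟨c, hc, h⟩ := hU.2 v
  refine ⟨c, hc, ?_⟩
  have h1 : U * U.conjTranspose = 1 := Matrix.mem_unitaryGroup_iff.mp hU.1
  rw [h, smul_mul_assoc, mul_assoc, h1, mul_one]

/-- The symplectic transvection `v ↦ v + ⟨v, w⟩ w`. -/
def transvection {n : ℕ} (w v : PauliVec n) : PauliVec n := v + sympVec v w • w

/-- The operator `exp (i π σ_w / 4) = (1 + i σ_w) / √2`. -/
noncomputable def transvectionOp {n : ℕ} (w : PauliVec n) : QubitOp n :=
  (((√2)⁻¹ : ℝ) : ℂ) • (1 + Complex.I • sigma w)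

theorem inv_sqrt_two_mul_self : (((√2)⁻¹ : ℝ) : ℂ) * (((√2)⁻¹ : ℝ) : ℂ) = 1 / 2 := by
  rw [← Complex.ofReal_mul, ← mul_inv, Real.mul_self_sqrt (by norm_num)]
  norm_num

theorem implements_transvectionOp {n : ℕ} (w : PauliVec n) :
    Implements (transvectionOp w) (transvection w) := by
  constructor
  · rw [Matrix.mem_unitaryGroup_iff, Matrix.star_eq_conjTranspose, transvectionOp,
      Matrix.conjTranspose_smul, Matrix.conjTranspose_add, Matrix.conjTranspose_smul,
      sigma_conjTranspose, Matrix.conjTranspose_one]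
    rw [Matrix.smul_mul, Matrix.mul_smul, smul_smul]
    have h1 : star (((√2)⁻¹ : ℝ) : ℂ) = (((√2)⁻¹ : ℝ) : ℂ) := Complex.conj_ofReal _
    have h2 : star Complex.I = -Complex.I := Complex.conj_I
    have h3 : (1 + Complex.I • sigma w) * (1 + -Complex.I • sigma w) = (2 : ℂ) • 1 := by
      rw [mul_add, add_mul, add_mul, mul_one, one_mul, mul_one, Matrix.smul_mul, Matrix.mul_smul,
        sigma_mul_self, smul_smul, two_smul]
      have : Complex.I * -Complex.I = 1 := by rw [mul_neg, Complex.I_mul_I, neg_neg]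
      rw [this, one_smul, neg_smul]
      abel
    rw [h1, h2, h3, inv_sqrt_two_mul_self, smul_smul]
    norm_num
  · intro v
    have hcomm := sigma_mul_comm w v
    have hs : sympVec w v = sympVec v w := by simp only [sympVec, symp_comm]
    rw [hs] at hcomm
    rcases eq_zero_or_one (sympVec v w) with h | h
    · refine ⟨1, by norm_num, ?_⟩
      have hv : transvection w v = v := by simp [transvection, h]
      rw [hv, one_smul, transvectionOp, Matrix.smul_mul, Matrix.mul_smul, add_mul, mul_add,
        one_mul, mul_one, Matrix.smul_mul, Matrix.mul_smul, hcomm, h, bitSign_zero, one_smul]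
    · obtain ⟨c, hc, hvw⟩ := exists_phase_sigma_mul v w
      have hv : transvection w v = v + w := by simp [transvection, h]
      refine ⟨-Complex.I * c, ?_, ?_⟩
      · rw [mul_pow, hc, Even.neg_pow (by decide), Complex.I_pow_four, one_mul]
      · have hb : bitSign 1 = -1 := by simp [bitSign]
        rw [h, hb] at hcomm
        rw [hv, mul_smul, ← Matrix.smul_mul c, ← hvw, transvectionOp, Matrix.smul_mul,
          Matrix.mul_smul, smul_comm (-Complex.I)]
        congr 1
        rw [add_mul, mul_add, one_mul, mul_one, Matrix.smul_mul, Matrix.mul_smul, hcomm,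
          mul_assoc, sigma_mul_self, mul_one, smul_add, smul_smul]
        have : -Complex.I * Complex.I = 1 := by rw [neg_mul, Complex.I_mul_I, neg_neg]
        rw [smul_smul (-Complex.I), this, one_smul, mul_neg_one, add_comm]

/-- The gate on the qubits `i` and `j` that implements the transvection by a Pauli string
supported on these two qubits. -/
noncomputable def transvectionGate {n : ℕ} (i j : Fin n) (hij : i ≠ j) (w : PauliVec n) :
    CliffordGate n where
  fst := i
  snd := j
  fst_ne_snd := hij
  gate := ⟨transvectionOp ![w i, w j], (implements_transvectionOp _).1⟩
  isClifford := by
    intro ν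
    obtain ⟨c, hc, h⟩ := (implements_transvectionOp ![w i, w j]).conj
      (fun i => pauliIndex.symm (ν i))
    rw [← pauliString_eq_sigma] at h
    exact ⟨c, eq_of_pow_four_eq_one hc, _, h⟩

theorem toOp_transvectionGate {n : ℕ} {i j : Fin n} (hij : i ≠ j) {w : PauliVec n}
    (hw : ∀ l, l ≠ i → l ≠ j → w l = 0) :
    (transvectionGate i j hij w).toOp = transvectionOp w := by
  have hpz : pauliMatrix (pauliIndex 0) = 1 := rfl
  have hone : ∀ x y : QubitBasis n, (1 : QubitOp n) x y =
      if ∀ l, l ≠ i → l ≠ j → x l = y l then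
        (1 : QubitOp 2) ![x i, x j] ![y i, y j] else 0 := by
    intro x y
    simp only [Matrix.one_apply]
    by_cases hxy : x = y
    · simp [hxy]
    · rw [if_neg hxy]
      split_ifs with h1 h2
      · exfalso
        apply hxy
        funext l
        by_cases hi : l = i
        · subst hi; exact congrFun h2 0
        · by_cases hj : l = j
          · subst hj; exact congrFun h2 1
          · exact h1 l hi hj
      · rfl
      · rfl
  have hsig : ∀ x y : QubitBasis n, sigma w x y =
      if ∀ l, l ≠ i → l ≠ j → x l = y l then
        sigma ![w i, w j] ![x i, x j] ![y i, y j] else 0 := by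
    intro x y
    simp only [sigma, pauliString, Matrix.of_apply, Fin.prod_univ_two]
    split_ifs with h
    · rw [← Finset.prod_subset (Finset.subset_univ {i, j}), Finset.prod_pair hij]
      · simp
      · intro l _ hl
        simp only [Finset.mem_insert, Finset.mem_singleton, not_or] at hl
        rw [hw l hl.1 hl.2, hpz, h l hl.1 hl.2, Matrix.one_apply_eq]
    · push Not at h
      obtain ⟨l, hi, hj, hl⟩ := h
      refine Finset.prod_eq_zero (Finset.mem_univ l) ?_
      rw [hw l hi hj, hpz, Matrix.one_apply_ne hl]
  ext x y
  simp only [CliffordGate.toOp, transvectionGate, transvectionOp, Matrix.of_apply,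
    Matrix.smul_apply, Matrix.add_apply, hone x y, hsig x y]
  by_cases h : ∀ l, l ≠ i → l ≠ j → x l = y l
  · simp only [if_pos h]
    exact if_pos h
  · simp only [if_neg h, smul_zero, add_zero]
    exact if_neg h

/-! ### Circuits -/

theorem foldl_layers {n : ℕ} (Ls : List (List (CliffordGate n))) (M : QubitOp n) :
    Ls.foldl (fun M L => (L.map CliffordGate.toOp).prod * M) M =
      Ls.foldl (fun M L => (L.map CliffordGate.toOp).prod * M) 1 * M := by
  induction Ls generalizing M with
  | nil => simp
  | cons L Ls ih =>
    rw [List.foldl_cons, List.foldl_cons, ih, ih ((L.map CliffordGate.toOp).prod * 1), mul_one,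
      mul_assoc]

/-- The map `f` of Pauli vectors is implemented by a circuit of depth at most `d`. -/
def Realizable {n : ℕ} (d : ℕ) (f : PauliVec n → PauliVec n) : Prop :=
  ∃ E : CliffordCircuit n, E.depth ≤ d ∧ Implements E.toOp f

theorem Realizable.id {n : ℕ} : Realizable 0 (id : PauliVec n → PauliVec n) :=
  ⟨⟨[], by simp⟩, le_rfl, Implements.one⟩

theorem Realizable.mono {n d d' : ℕ} {f : PauliVec n → PauliVec n} (h : Realizable d f)
    (hd : d ≤ d') : Realizable d' f := by
  obtain ⟨E, h1, h2⟩ := h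
  exact ⟨E, h1.trans hd, h2⟩

theorem Realizable.comp {n d d' : ℕ} {f g : PauliVec n → PauliVec n} (hg : Realizable d' g)
    (hf : Realizable d f) : Realizable (d + d') (g ∘ f) := by
  obtain ⟨E, h1, h2⟩ := hf
  obtain ⟨E', h1', h2'⟩ := hg
  refine ⟨⟨E.layers ++ E'.layers, ?_⟩, ?_, ?_⟩
  · intro L hL
    rcases List.mem_append.mp hL with h | h
    · exact E.disjoint L h
    · exact E'.disjoint L h
  · simp only [CliffordCircuit.depth, List.length_append] at *
    omega
  · have : CliffordCircuit.toOp ⟨E.layers ++ E'.layers, by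
        intro L hL
        rcases List.mem_append.mp hL with h | h
        · exact E.disjoint L h
        · exact E'.disjoint L h⟩ = E'.toOp * E.toOp := by
      simp only [CliffordCircuit.toOp, List.foldl_append]
      rw [foldl_layers]
    rw [this]
    exact h2.mul h2'

/-! ### Transvections in parallel -/

section Parallel

variable {n : ℕ} {ι : Type*} [DecidableEq ι]

/-- The symplectic form restricted to the qubits of colour `c`. -/
def classSymp (cl : Fin n → ι) (c : ι) (v w : PauliVec n) : ZMod 2 :=
  ∑ j with cl j = c, symp (v j) (w j)

/-- The qubits are partitioned by the colouring `cl`; every colour class undergoes the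
transvection by the restriction of `w` to the class. -/
def parTransvection (cl : Fin n → ι) (w v : PauliVec n) : PauliVec n :=
  fun i => v i + classSymp cl (cl i) v w • w i

theorem classSymp_congr {cl : Fin n → ι} {c : ι} {v v' w w' : PauliVec n}
    (hv : ∀ j, cl j = c → v j = v' j) (hw : ∀ j, cl j = c → w j = w' j) :
    classSymp cl c v w = classSymp cl c v' w' := by
  refine Finset.sum_congr rfl fun j hj => ?_
  rw [Finset.mem_filter] at hj
  rw [hv j hj.2, hw j hj.2]

theorem classSymp_add_left (cl : Fin n → ι) (c : ι) (v v' w : PauliVec n) :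
    classSymp cl c (v + v') w = classSymp cl c v w + classSymp cl c v' w := by
  simp [classSymp, symp_add_left, Finset.sum_add_distrib]

theorem classSymp_add_right (cl : Fin n → ι) (c : ι) (v w w' : PauliVec n) :
    classSymp cl c v (w + w') = classSymp cl c v w + classSymp cl c v w' := by
  simp [classSymp, symp_add_right, Finset.sum_add_distrib]

theorem classSymp_smul_left (cl : Fin n → ι) (c : ι) (a : ZMod 2) (v w : PauliVec n) :
    classSymp cl c (a • v) w = a * classSymp cl c v w := by
  rcases eq_zero_or_one a with rfl | rfl
  · simp [classSymp, symp_zero_left]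
  · simp

theorem classSymp_self (cl : Fin n → ι) (c : ι) (v : PauliVec n) : classSymp cl c v v = 0 := by
  simp [classSymp, symp_self]

theorem classSymp_comm (cl : Fin n → ι) (c : ι) (v w : PauliVec n) :
    classSymp cl c v w = classSymp cl c w v := by
  simp only [classSymp, symp_comm]

theorem parTransvection_add (cl : Fin n → ι) (w v v' : PauliVec n) :
    parTransvection cl w (v + v') = parTransvection cl w v + parTransvection cl w v' := by
  funext i
  simp only [parTransvection, classSymp_add_left, Pi.add_apply, add_smul]
  abel

theorem classSymp_parTransvection (cl : Fin n → ι) (c : ι) (u v w : PauliVec n) :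
    classSymp cl c (parTransvection cl u v) w =
      classSymp cl c v w + classSymp cl c v u * classSymp cl c u w := by
  rw [← classSymp_smul_left, ← classSymp_add_left]
  refine classSymp_congr (fun j hj => ?_) fun j _ => rfl
  simp [parTransvection, hj]

theorem parTransvection_apply (cl : Fin n → ι) (w v : PauliVec n) (i : Fin n) :
    parTransvection cl w v i = v i + classSymp cl (cl i) v w • w i := rfl

theorem parTransvection_self (cl : Fin n → ι) (w v : PauliVec n) :
    parTransvection cl w (parTransvection cl w v) = v := by
  funext i
  have h : ∀ a : ZMod 2, a + a = 0 := by decide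
  rw [parTransvection_apply, classSymp_parTransvection, classSymp_self, mul_zero, add_zero,
    parTransvection_apply, add_assoc, ← add_smul, h, zero_smul, add_zero]

/-- A parallel transvection whose string is supported on at most two qubits of each class takes a
single layer: the gates of different classes act on disjoint pairs of qubits. -/
theorem realizable_layer (cl : Fin n → ι) (w : PauliVec n)
    (h : ∀ c, (∃ i, cl i = c ∧ w i ≠ 0) → ∃ i j, i ≠ j ∧ cl i = c ∧ cl j = c ∧
      ∀ l, cl l = c → l ≠ i → l ≠ j → w l = 0) :
    Realizable 1 (parTransvection cl w) := by
  have key : ∀ cs : List ι, cs.Nodup → (∀ c ∈ cs, ∃ i, cl i = c ∧ w i ≠ 0) →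
      ∃ L : List (CliffordGate n), L.Pairwise CliffordGate.Disjoint ∧
        (∀ G ∈ L, cl G.fst ∈ cs ∧ cl G.snd = cl G.fst) ∧
        Implements (L.map CliffordGate.toOp).prod
          (fun v i => if cl i ∈ cs then parTransvection cl w v i else v i) := by
    intro cs
    induction cs with
    | nil => exact fun _ _ => ⟨[], by simp, by simp, by
        simp only [List.not_mem_nil, if_false, List.map_nil, List.prod_nil]
        exact Implements.one⟩
    | cons c cs ih =>
      intro hnd hcs
      obtain ⟨L, hL, hLc, hI⟩ := ih hnd.of_cons fun d hd => hcs d (List.mem_cons_of_mem _ hd)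
      have hc : c ∉ cs := (List.nodup_cons.mp hnd).1
      obtain ⟨i, j, hij, hi, hj, hw⟩ := h c (hcs c List.mem_cons_self)
      let wc : PauliVec n := fun l => if cl l = c then w l else 0
      refine ⟨transvectionGate i j hij wc :: L, ?_, ?_, ?_⟩
      · rw [List.pairwise_cons]
        refine ⟨fun G hG => ?_, hL⟩
        obtain ⟨h1, h2⟩ := hLc G hG
        have hne : ∀ a b : Fin n, cl a = c → cl b = cl G.fst → a ≠ b := by
          rintro a b ha hb rfl
          rw [← hb, ha] at h1
          exact hc h1
        exact ⟨hne _ _ hi rfl, hne _ _ hi h2, hne _ _ hj rfl, hne _ _ hj h2⟩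
      · intro G hG
        rcases List.mem_cons.mp hG with rfl | hG
        · exact ⟨by simp [transvectionGate, hi], by simp [transvectionGate, hi, hj]⟩
        · exact ⟨List.mem_cons_of_mem _ (hLc G hG).1, (hLc G hG).2⟩
      · have hG : Implements (transvectionGate i j hij wc).toOp (transvection wc) := by
          rw [toOp_transvectionGate]
          · exact implements_transvectionOp _
          · intro l hli hlj
            by_cases hl : cl l = c
            · simp [wc, hl, hw l hl hli hlj]
            · simp [wc, hl]
        rw [List.map_cons, List.prod_cons]
        convert hI.mul hG using 1
        funext v
        have hs : sympVec (fun i => if cl i ∈ cs then parTransvection cl w v i else v i) wc =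
            classSymp cl c v w := by
          rw [sympVec, classSymp, Finset.sum_filter]
          refine Finset.sum_congr rfl fun l _ => ?_
          by_cases hl : cl l = c
          · have : cl l ∉ cs := hl ▸ hc
            simp [wc, hl, hc]
          · simp [wc, hl, symp_zero_right]
        funext l
        simp only [Function.comp, transvection, Pi.add_apply, Pi.smul_apply, hs]
        by_cases hl : cl l = c
        · simp [wc, hl, hc, parTransvection]
        · by_cases hl' : cl l ∈ cs
          · simp [wc, hl, hl']
          · simp [wc, hl, hl']
  let s : Finset ι := (Finset.univ.filter fun i => w i ≠ 0).image cl
  obtain ⟨L, hL, -, hI⟩ := key s.toList s.nodup_toList (by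
    intro c hc
    simp only [s, Finset.mem_toList, Finset.mem_image, Finset.mem_filter, Finset.mem_univ,
      true_and] at hc
    obtain ⟨i, hi, rfl⟩ := hc
    exact ⟨i, rfl, hi⟩)
  refine ⟨⟨[L], by simpa using hL⟩, by simp [CliffordCircuit.depth], ?_⟩
  have h1 : CliffordCircuit.toOp ⟨[L], by simpa using hL⟩ = (L.map CliffordGate.toOp).prod := by
    simp [CliffordCircuit.toOp]
  rw [h1]
  convert hI using 1
  funext v i
  split_ifs with hi
  · rfl
  · rw [parTransvection_apply]
    have : w i = 0 := by
      by_contra hw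
      apply hi
      simp only [s, Finset.mem_toList, Finset.mem_image, Finset.mem_filter, Finset.mem_univ,
        true_and]
      exact ⟨i, hw, rfl⟩
    simp [this]

/-- A transvection by a string `w` of weight at least two is conjugate, by a transvection on two
of the qubits of `w`, to one whose string has one qubit less in its support. Unrolling this
reduces every transvection to two-qubit ones, in all colour classes at the same time. -/
theorem realizable_parTransvection (cl : Fin n → ι) (d : ℕ) (w : PauliVec n)
    (hd : ∀ c, (Finset.univ.filter fun i => cl i = c ∧ w i ≠ 0).card ≤ d + 1)
    (hp : ∀ i, w i ≠ 0 → ∃ j, j ≠ i ∧ cl j = cl i) :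
    Realizable (2 * d + 1) (parTransvection cl w) := by
  induction d generalizing w with
  | zero =>
    refine realizable_layer cl w fun c hc => ?_
    obtain ⟨i, rfl, hi⟩ := hc
    obtain ⟨j, hj, hji⟩ := hp i hi
    refine ⟨i, j, hj.symm, rfl, hji, fun l hl hli _ => ?_⟩
    by_contra hwl
    exact hli (Finset.card_le_one.mp (hd (cl i)) l (by simp [hl, hwl]) i (by simp [hi]))
  | succ d ih =>
    -- In a class with two qubits `i`, `j` of the support of `w`, the string `u` agrees with `w` at
    -- `j` and differs from it at `i`, where it anticommutes; then `w + u` vanishes at `j`.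
    have hex : ∀ c, ∃ u : PauliVec n, (∀ l, u l ≠ 0 → w l ≠ 0) ∧
        ((∀ l, cl l = c → u l = 0) ∨ (classSymp cl c w u = 1 ∧
          ∃ i j, i ≠ j ∧ cl i = c ∧ cl j = c ∧ ∀ l, cl l = c → l ≠ i → l ≠ j → u l = 0)) ∧
        (Finset.univ.filter fun i => cl i = c ∧ w i + u i ≠ 0).card ≤ d + 1 := by
      intro c
      rcases le_or_gt (Finset.univ.filter fun i => cl i = c ∧ w i ≠ 0).card 1 with h1 | h1
      · exact ⟨0, by simp, Or.inl (by simp), by simpa using h1.trans (by omega)⟩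
      · obtain ⟨i, hi, j, hj, hij⟩ := Finset.one_lt_card.mp h1
        simp only [Finset.mem_filter, Finset.mem_univ, true_and] at hi hj
        have hr : ∀ p : ZMod 2 × ZMod 2, p ≠ 0 → ∃ r, symp p r = 1 ∧ r ≠ 0 ∧ p + r ≠ 0 := by
          decide
        obtain ⟨r, hr1, hr0, hr2⟩ := hr _ hi.2
        have hself : ∀ p : ZMod 2 × ZMod 2, p + p = 0 := by decide
        let u : PauliVec n := fun l => if l = i then r else if l = j then w j else 0
        have hui : u i = r := by simp [u]
        have huj : u j = w j := by simp [u, hij.symm]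
        have hul : ∀ l, l ≠ i → l ≠ j → u l = 0 := fun l h h' => by simp [u, h, h']
        refine ⟨u, ?_, Or.inr ⟨?_, i, j, hij, hi.1, hj.1, fun l _ => hul l⟩, ?_⟩
        · intro l hl
          by_cases h : l = i
          · exact h ▸ hi.2
          · by_cases h' : l = j
            · exact h' ▸ hj.2
            · exact absurd (hul l h h') hl
        · rw [classSymp, Finset.sum_eq_single i]
          · rw [hui, hr1]
          · intro l _ hl
            by_cases h' : l = j
            · rw [h', huj, symp_self]
            · rw [hul l hl h', symp_zero_right]
          · intro h
            simp [hi.1] at h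
        · have hlt : (Finset.univ.filter fun i => cl i = c ∧ w i + u i ≠ 0).card <
              (Finset.univ.filter fun i => cl i = c ∧ w i ≠ 0).card := by
            refine Finset.card_lt_card (Finset.ssubset_iff_of_subset ?_ |>.mpr ⟨j, ?_, ?_⟩)
            · intro l
              simp only [Finset.mem_filter, Finset.mem_univ, true_and]
              rintro ⟨hl, h⟩
              refine ⟨hl, ?_⟩
              by_cases h' : l = i
              · exact h' ▸ hi.2
              · by_cases h'' : l = j
                · exact h'' ▸ hj.2
                · rwa [hul l h' h'', add_zero] at h
            · simp [hj]
            · simp [huj, hself]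
          have := hd c
          omega
    choose u hu1 hu2 hu3 using hex
    let U : PauliVec n := fun l => u (cl l) l
    have hclass : ∀ c l, cl l = c → U l = u c l := by rintro c l rfl; rfl
    have hU : Realizable 1 (parTransvection cl U) := by
      refine realizable_layer cl U fun c hc => ?_
      obtain ⟨i, hi, hUi⟩ := hc
      rcases hu2 c with h | ⟨-, i, j, hij, hi, hj, h⟩
      · exact absurd (by rw [hclass c i hi]; exact h i hi) hUi
      · exact ⟨i, j, hij, hi, hj, fun l hl h1 h2 => by rw [hclass c l hl]; exact h l hl h1 h2⟩
    have hW : Realizable (2 * d + 1) (parTransvection cl (w + U)) := by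
      refine ih (w + U) (fun c => ?_) fun i hi => hp i fun h => hi ?_
      · refine le_trans (Finset.card_le_card ?_) (hu3 c)
        intro l
        simp only [Finset.mem_filter, Finset.mem_univ, true_and, Pi.add_apply]
        rintro ⟨hl, h⟩
        exact ⟨hl, by rwa [hclass c l hl] at h⟩
      · have : U i = 0 := by
          by_contra h'
          exact hu1 _ i h' h
        rw [Pi.add_apply, h, this, add_zero]
    -- Conjugation by the transvection by `U` takes `w + U` to `w`, as `⟨w, U⟩ = 1`.
    have heq : parTransvection cl w =
        parTransvection cl U ∘ parTransvection cl (w + U) ∘ parTransvection cl U := by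
      funext v i
      simp only [Function.comp]
      rw [parTransvection_apply, parTransvection_apply, parTransvection_apply,
        parTransvection_apply]
      simp only [classSymp_parTransvection, classSymp_add_right, classSymp_add_left,
        classSymp_self]
      rcases hu2 (cl i) with h | ⟨h, -⟩
      · have h0 : ∀ v, classSymp cl (cl i) v U = 0 := by
          intro v
          rw [classSymp_congr (v' := v) (w' := 0) (fun _ _ => rfl) fun j hj => by
            rw [hclass _ j hj]; exact h j hj]
          simp [classSymp, symp_zero_right]
        have hUi : U i = 0 := h i rfl
        simp only [h0, classSymp_comm cl (cl i) U, hUi, Pi.add_apply]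
        simp
      · have h1 : classSymp cl (cl i) w U = 1 := by
          rw [classSymp_congr (v' := w) (w' := u (cl i)) (fun _ _ => rfl) fun j hj =>
            hclass _ j hj, h]
        have h1' : classSymp cl (cl i) U w = 1 := by rw [classSymp_comm, h1]
        rw [h1, h1']
        simp only [Pi.add_apply]
        generalize classSymp cl (cl i) v w = a
        generalize classSymp cl (cl i) v U = b
        generalize U i = p
        generalize w i = q
        generalize v i = r
        revert a b p q r
        decide
    rw [heq]
    exact (hU.comp (hW.comp hU)).mono (by omega)

end Parallel

/-! ### The code prepared by a circuit -/

/-- The Pauli strings that commute with `Z_i` for all `i ≥ k`. -/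
def ancillaNormalizer (n k : ℕ) : AddSubgroup (PauliVec n) where
  carrier := {v | ∀ i : Fin n, k ≤ (i : ℕ) → (v i).1 = 0}
  add_mem' := by
    intro v w hv hw i hi
    simp [hv i hi, hw i hi]
  zero_mem' := by simp
  neg_mem' := by
    intro v hv i hi
    simp [hv i hi]

/-- The products of the operators `Z_i` with `i ≥ k`. -/
def ancillaStabilizer (n k : ℕ) : AddSubgroup (PauliVec n) where
  carrier := {v | ∀ i, (v i).1 = 0 ∧ ((i : ℕ) < k → (v i).2 = 0)}
  add_mem' := by
    intro v w hv hw i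
    exact ⟨by simp [(hv i).1, (hw i).1], fun h => by simp [(hv i).2 h, (hw i).2 h]⟩
  zero_mem' := by simp
  neg_mem' := by
    intro v hv i
    exact ⟨by simp [(hv i).1], fun h => by simp [(hv i).2 h]⟩

theorem pauliMatrix_mul_of_fst_eq_zero {p q : ZMod 2 × ZMod 2} (hp : p.1 = 0) (hq : q.1 = 0) :
    pauliMatrix (pauliIndex p) * pauliMatrix (pauliIndex q) = pauliMatrix (pauliIndex (p + q)) := by
  obtain ⟨x, z⟩ := p
  obtain ⟨x', z'⟩ := q
  simp only at hp hq
  subst hp hq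
  rcases eq_zero_or_one z with rfl | rfl <;> rcases eq_zero_or_one z' with rfl | rfl
  · simp [show pauliIndex ((0 : ZMod 2), (0 : ZMod 2)) = 0 from rfl, pauliMatrix]
  · simp [show pauliIndex ((0 : ZMod 2), (0 : ZMod 2)) = 0 from rfl, pauliMatrix]
  · simp [show pauliIndex ((0 : ZMod 2), (0 : ZMod 2)) = 0 from rfl, pauliMatrix]
  · rw [pauliMatrix_mul_self]
    rfl

theorem sigma_mul_of_fst_eq_zero {n : ℕ} {v w : PauliVec n} (hv : ∀ i, (v i).1 = 0)
    (hw : ∀ i, (w i).1 = 0) : sigma v * sigma w = sigma (v + w) := by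
  rw [sigma_eq_tensorOp, sigma_eq_tensorOp, tensorOp_mul]
  congr 1
  funext i
  exact pauliMatrix_mul_of_fst_eq_zero (hv i) (hw i)

theorem sigma_mulVec_of_fst_eq_zero {n : ℕ} {v : PauliVec n} (hv : ∀ i, (v i).1 = 0)
    (u : QubitBasis n → ℂ) (x : QubitBasis n) : (sigma v).mulVec u x =
      (∏ i, pauliMatrix (pauliIndex (v i)) (x i) (x i)) * u x := by
  have hoff : ∀ p : ZMod 2 × ZMod 2, p.1 = 0 → ∀ a b : Fin 2, a ≠ b →
      pauliMatrix (pauliIndex p) a b = 0 := by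
    rintro ⟨x, z⟩ h a b hab
    simp only at h
    subst h
    rcases eq_zero_or_one z with rfl | rfl
    · simp [show pauliIndex ((0 : ZMod 2), (0 : ZMod 2)) = 0 from rfl, pauliMatrix, hab]
    · rw [show pauliIndex ((0 : ZMod 2), (1 : ZMod 2)) = 3 from rfl]
      fin_cases a <;> fin_cases b <;> simp_all [pauliMatrix]
  rw [Matrix.mulVec, dotProduct, Finset.sum_eq_single x]
  · rfl
  · intro y _ hy
    obtain ⟨i, hi⟩ := Function.ne_iff.mp hy
    have : sigma v x y = 0 := Finset.prod_eq_zero (Finset.mem_univ i) (hoff _ (hv i) _ _ hi.symm)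
    rw [this, zero_mul]
  · simp

theorem pauliMatrix_apply_zero_zero {p : ZMod 2 × ZMod 2} (hp : p.1 = 0) :
    pauliMatrix (pauliIndex p) 0 0 = 1 := by
  obtain ⟨x, z⟩ := p
  simp only at hp
  subst hp
  rcases eq_zero_or_one z with rfl | rfl
  · rfl
  · rfl

theorem sigma_ne_neg_one {n : ℕ} {v : PauliVec n} (hv : ∀ i, (v i).1 = 0) :
    sigma v ≠ -1 := by
  intro h
  have h1 : sigma v 0 0 = 1 := by
    change ∏ i, pauliMatrix (pauliIndex (v i)) 0 0 = 1
    exact Finset.prod_eq_one fun i _ => pauliMatrix_apply_zero_zero (hv i)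
  rw [h] at h1
  norm_num at h1

/-- The joint `+1`-eigenspace of the operators `Z_i` with `i ≥ k` consists of the vectors
`φ ⊗ |0⟩ ^ (n - k)`. -/
theorem mem_range_withAncillas {k n : ℕ} (hk : k ≤ n) (u : QubitBasis n → ℂ) :
    (∃ φ, withAncillas hk φ = u) ↔
      ∀ v ∈ ancillaStabilizer n k, (sigma v).mulVec u = u := by
  constructor
  · rintro ⟨φ, rfl⟩ v hv
    funext x
    rw [sigma_mulVec_of_fst_eq_zero fun i => (hv i).1]
    by_cases hx : ∀ i : Fin n, k ≤ (i : ℕ) → x i = 0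
    · rw [Finset.prod_eq_one, one_mul]
      intro i _
      rcases lt_or_ge (i : ℕ) k with hi | hi
      · rw [show v i = 0 from Prod.ext (hv i).1 ((hv i).2 hi)]
        exact Matrix.one_apply_eq _
      · rw [hx i hi]
        exact pauliMatrix_apply_zero_zero (hv i).1
    · simp only [withAncillas, if_neg hx, mul_zero]
  · intro h
    refine ⟨fun y => u fun i => if hi : (i : ℕ) < k then y ⟨i, hi⟩ else 0, ?_⟩
    funext x
    simp only [withAncillas]
    split_ifs with hx
    · congr 1
      funext i
      split_ifs with hi
      · rfl
      · exact (hx i (not_lt.mp hi)).symm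
    · push Not at hx
      obtain ⟨i, hi, hxi⟩ := hx
      have hxi1 : x i = 1 := by
        have : ∀ a : Fin 2, a ≠ 0 → a = 1 := by decide
        exact this _ hxi
      let v : PauliVec n := Function.update 0 i (0, 1)
      have hv : v ∈ ancillaStabilizer n k := by
        intro j
        by_cases hj : j = i
        · subst hj
          simp only [v, Function.update_self]
          exact ⟨trivial, fun h => absurd hi (not_le.mpr h)⟩
        · simp [v, hj]
      have h1 := congrFun (h v hv) x
      rw [sigma_mulVec_of_fst_eq_zero fun i => (hv i).1, Finset.prod_eq_single i] at h1
      · have h2 : pauliMatrix (pauliIndex (v i)) (x i) (x i) = -1 := by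
          simp only [v, Function.update_self, hxi1]
          rfl
        rw [h2] at h1
        have h3 : u x = 0 := by linear_combination (-1 / 2 : ℂ) * h1
        exact h3.symm
      · intro j _ hj
        simp only [v, Function.update_of_ne hj]
        exact Matrix.one_apply_eq _
      · simp

/-- The linear map that appends `n - k` ancillas in the state `|0⟩`. -/
def withAncillasLinear {k n : ℕ} (hk : k ≤ n) : (QubitBasis k → ℂ) →ₗ[ℂ] (QubitBasis n → ℂ) where
  toFun := withAncillas hk
  map_add' φ ψ := by
    funext x
    simp only [withAncillas, Pi.add_apply]
    split_ifs <;> simp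
  map_smul' c φ := by
    funext x
    simp only [withAncillas, Pi.smul_apply, RingHom.id_apply]
    split_ifs <;> simp

theorem withAncillas_injective {k n : ℕ} (hk : k ≤ n) :
    Function.Injective (withAncillas hk) := by
  intro φ ψ h
  funext y
  have h1 := congrFun h fun i => if hi : (i : ℕ) < k then y ⟨i, hi⟩ else 0
  have h2 : ∀ i : Fin n, k ≤ (i : ℕ) → (if hi : (i : ℕ) < k then y ⟨i, hi⟩ else 0) = 0 :=
    fun i hi => dif_neg (not_lt.mpr hi)
  simp only [withAncillas] at h1
  rw [if_pos h2, if_pos h2] at h1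
  simpa using h1

section Code

variable {n : ℕ} {U : QubitOp n} {f : PauliVec n → PauliVec n}

theorem Implements.conjTranspose_mul (hU : Implements U f) : U.conjTranspose * U = 1 :=
  Matrix.mem_unitaryGroup_iff'.mp hU.1

theorem Implements.mul_conjTranspose (hU : Implements U f) : U * U.conjTranspose = 1 :=
  Matrix.mem_unitaryGroup_iff.mp hU.1

theorem Implements.conj_mul_conj (hU : Implements U f) (M M' : QubitOp n) :
    U * M * U.conjTranspose * (U * M' * U.conjTranspose) = U * (M * M') * U.conjTranspose := by
  calc U * M * U.conjTranspose * (U * M' * U.conjTranspose)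
      = U * M * (U.conjTranspose * U) * M' * U.conjTranspose := by simp only [mul_assoc]
    _ = _ := by rw [hU.conjTranspose_mul, mul_one]; simp only [mul_assoc]

theorem Implements.conj_injective (hU : Implements U f) {M M' : QubitOp n}
    (h : U * M * U.conjTranspose = U * M' * U.conjTranspose) : M = M' := by
  have h1 : ∀ M : QubitOp n, U.conjTranspose * (U * M * U.conjTranspose) * U = M := by
    intro M
    calc U.conjTranspose * (U * M * U.conjTranspose) * U
        = (U.conjTranspose * U) * M * (U.conjTranspose * U) := by simp only [mul_assoc]
      _ = M := by rw [hU.conjTranspose_mul, one_mul, mul_one]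
  rw [← h1 M, h, h1]

theorem Implements.conj_mem (hU : Implements U f) (v : PauliVec n) :
    U * sigma v * U.conjTranspose ∈ Matrix.unitaryGroup (QubitBasis n) ℂ := by
  have h1 : sigma v ∈ Matrix.unitaryGroup (QubitBasis n) ℂ := by
    rw [Matrix.mem_unitaryGroup_iff, Matrix.star_eq_conjTranspose, sigma_conjTranspose,
      sigma_mul_self]
  exact mul_mem (mul_mem hU.1 h1) (Unitary.star_mem hU.1)

/-- The stabilizer code whose stabilizer consists of the operators `U Z U†`, where `Z` runs through
the products of the operators `Z_i` with `i ≥ k`. -/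
def Implements.code (hU : Implements U f) (k : ℕ) : StabilizerCode n where
  stabilizer :=
    { carrier := {g | ∃ v ∈ ancillaStabilizer n k, (g : QubitOp n) = U * sigma v * U.conjTranspose}
      mul_mem' := by
        rintro g h ⟨v, hv, hg⟩ ⟨w, hw, hh⟩
        refine ⟨v + w, add_mem hv hw, ?_⟩
        rw [Submonoid.coe_mul, hg, hh, hU.conj_mul_conj,
          sigma_mul_of_fst_eq_zero (fun i => (hv i).1) fun i => (hw i).1]
      one_mem' := ⟨0, zero_mem _, by simp [sigma_zero, hU.mul_conjTranspose]⟩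
      inv_mem' := by
        rintro g ⟨v, hv, hg⟩
        refine ⟨v, hv, ?_⟩
        rw [← Unitary.star_eq_inv, Unitary.coe_star, hg, Matrix.star_eq_conjTranspose,
          Matrix.conjTranspose_mul, Matrix.conjTranspose_mul, sigma_conjTranspose,
          Matrix.conjTranspose_conjTranspose, mul_assoc] }
  isPauli := by
    rintro g ⟨v, -, hg⟩
    obtain ⟨c, hc, h⟩ := hU.conj v
    exact ⟨c, eq_of_pow_four_eq_one hc, _, hg.trans h⟩
  comm := by
    rintro g ⟨v, hv, hg⟩ h ⟨w, hw, hh⟩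
    apply Subtype.ext
    rw [Submonoid.coe_mul, Submonoid.coe_mul, hg, hh, hU.conj_mul_conj, hU.conj_mul_conj,
      sigma_mul_of_fst_eq_zero (fun i => (hv i).1) fun i => (hw i).1,
      sigma_mul_of_fst_eq_zero (fun i => (hw i).1) fun i => (hv i).1, add_comm]
  neg_one_notMem := by
    rintro g ⟨v, hv, hg⟩ h
    apply sigma_ne_neg_one fun i => (hv i).1
    apply hU.conj_injective
    rw [← hg, h, mul_neg, mul_one, neg_mul, hU.mul_conjTranspose]

theorem Implements.codeSpace_eq (hU : Implements U f) {k : ℕ} (hk : k ≤ n) :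
    (hU.code k).codeSpace = LinearMap.range (U.mulVecLin ∘ₗ withAncillasLinear hk) := by
  ext u
  have h1 : u ∈ (hU.code k).codeSpace ↔
      ∀ v ∈ ancillaStabilizer n k, (sigma v).mulVec (U.conjTranspose.mulVec u) =
        U.conjTranspose.mulVec u := by
    constructor
    · intro hu v hv
      have := hu ⟨_, hU.conj_mem v⟩ ⟨v, hv, rfl⟩
      simp only at this
      nth_rewrite 2 [← this]
      rw [Matrix.mulVec_mulVec, Matrix.mulVec_mulVec, ← mul_assoc, ← mul_assoc,
        hU.conjTranspose_mul, one_mul]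
    · rintro h g ⟨v, hv, hg⟩
      rw [hg, mul_assoc, ← Matrix.mulVec_mulVec, ← Matrix.mulVec_mulVec, h v hv,
        Matrix.mulVec_mulVec, hU.mul_conjTranspose, Matrix.one_mulVec]
  rw [h1, ← mem_range_withAncillas hk]
  constructor
  · rintro ⟨φ, hφ⟩
    refine ⟨φ, ?_⟩
    simp only [LinearMap.comp_apply, withAncillasLinear, LinearMap.coe_mk, AddHom.coe_mk,
      Matrix.mulVecLin_apply, hφ, Matrix.mulVec_mulVec, hU.mul_conjTranspose, Matrix.one_mulVec]
  · rintro ⟨φ, hφ⟩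
    refine ⟨φ, ?_⟩
    rw [← hφ]
    simp only [LinearMap.comp_apply, withAncillasLinear, LinearMap.coe_mk, AddHom.coe_mk,
      Matrix.mulVecLin_apply, Matrix.mulVec_mulVec, hU.conjTranspose_mul, Matrix.one_mulVec]

theorem Implements.encodesQubits (hU : Implements U f) {k : ℕ} (hk : k ≤ n) :
    (hU.code k).EncodesQubits k := by
  have hinj : Function.Injective (U.mulVecLin ∘ₗ withAncillasLinear hk) := by
    have h1 : Function.Injective U.mulVecLin := by
      intro x y h
      have := congrArg U.conjTranspose.mulVec h
      simpa only [Matrix.mulVecLin_apply, Matrix.mulVec_mulVec, hU.conjTranspose_mul,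
        Matrix.one_mulVec] using this
    exact h1.comp (withAncillas_injective hk)
  rw [StabilizerCode.EncodesQubits, hU.codeSpace_eq hk, LinearMap.finrank_range_of_inj hinj]
  simp

theorem Implements.sigma_apply (hU : Implements U f) (v : PauliVec n) :
    ∃ c : ℂ, c ≠ 0 ∧ sigma (f v) = c • (U * sigma v * U.conjTranspose) := by
  obtain ⟨c, hc, h⟩ := hU.conj v
  have hc0 : c ≠ 0 := by
    rintro rfl
    norm_num at hc
  exact ⟨c⁻¹, inv_ne_zero hc0, by rw [h, smul_smul, inv_mul_cancel₀ hc0, one_smul]⟩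

theorem Implements.inNormalizer_iff (hU : Implements U f) {k : ℕ} (v : PauliVec n) :
    (hU.code k).InNormalizer (fun i => pauliIndex (f v i)) ↔ v ∈ ancillaNormalizer n k := by
  have hcomm : ∀ w : PauliVec n, (U * sigma w * U.conjTranspose * sigma (f v) =
      sigma (f v) * (U * sigma w * U.conjTranspose) ↔ sympVec w v = 0) := by
    intro w
    obtain ⟨c, hc, h⟩ := hU.sigma_apply v
    rw [h, Matrix.mul_smul, Matrix.smul_mul, hU.conj_mul_conj, hU.conj_mul_conj]
    constructor
    · intro h1
      have h2 := hU.conj_injective (smul_right_injective _ hc h1)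
      rcases eq_zero_or_one (sympVec w v) with h0 | h0
      · exact h0
      · exfalso
        rw [sigma_mul_comm w v, h0] at h2
        have h3 : sigma v * sigma w = 0 := by
          have hb : bitSign 1 = -1 := by simp [bitSign]
          rw [hb, neg_one_smul] at h2
          ext x y
          have := congrFun (congrFun h2 x) y
          simp only [Matrix.neg_apply] at this
          rw [Matrix.zero_apply]
          linear_combination (-1 / 2 : ℂ) * this
        have h4 : sigma v * sigma w * sigma w = 0 := by rw [h3, zero_mul]
        rw [mul_assoc, sigma_mul_self, mul_one] at h4
        exact sigma_ne_zero v h4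
    · intro h0
      rw [sigma_mul_comm w v, h0, bitSign_zero, one_smul]
  constructor
  · intro h i hi
    let w : PauliVec n := Function.update 0 i (0, 1)
    have hw : w ∈ ancillaStabilizer n k := by
      intro j
      by_cases hj : j = i
      · subst hj
        simp only [w, Function.update_self]
        exact ⟨trivial, fun h => absurd hi (not_le.mpr h)⟩
      · simp [w, hj]
    have h1 := (hcomm w).mp (h ⟨_, hU.conj_mem w⟩ ⟨w, hw, rfl⟩)
    rw [sympVec, Finset.sum_eq_single i] at h1
    · simpa [w, symp] using h1
    · intro j _ hj
      simp [w, hj, symp]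
    · simp
  · rintro hv g ⟨w, hw, hg⟩
    rw [hg]
    refine (hcomm w).mpr (Finset.sum_eq_zero fun i _ => ?_)
    rw [symp, (hw i).1, zero_mul, zero_add]
    rcases lt_or_ge (i : ℕ) k with hi | hi
    · rw [(hw i).2 hi, zero_mul]
    · rw [hv i hi, mul_zero]

theorem Implements.exists_of_inStabilizer (hU : Implements U f) {k : ℕ} {ν : Fin n → Fin 4}
    (h : (hU.code k).InStabilizer ν) :
    ∃ v ∈ ancillaStabilizer n k, ν = fun i => pauliIndex (f v i) := by
  obtain ⟨g, ⟨v, hv, hg⟩, c, hc⟩ := h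
  refine ⟨v, hv, ?_⟩
  obtain ⟨c', -, h'⟩ := hU.sigma_apply v
  rw [← hg, hc, pauliString_eq_sigma, smul_smul] at h'
  rw [eq_of_sigma_eq_smul h']
  simp

end Code

/-- The number of qubits on which a Pauli vector is nonzero. -/
def vecWeight {n : ℕ} (v : PauliVec n) : ℕ := (Finset.univ.filter fun i => v i ≠ 0).card

theorem pauliWeight_pauliIndex {n : ℕ} (v : PauliVec n) :
    pauliWeight (fun i => pauliIndex (v i)) = vecWeight v := by
  have h : ∀ p : ZMod 2 × ZMod 2, pauliIndex p ≠ 0 ↔ p ≠ 0 := by decide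
  simp only [pauliWeight, vecWeight, h]

/-- Among the images of the normalizer there is a nonzero one supported on the first `w`
qubits, by counting. -/
theorem exists_normalizer_weight_le {n k w : ℕ} (hk : k ≤ n) (hw : n < 2 * w + k) (hwn : w ≤ n)
    {f : PauliVec n → PauliVec n}
    (hadd : ∀ v v', f (v + v') = f v + f v') :
    ∃ v ∈ ancillaNormalizer n k, v ≠ 0 ∧ vecWeight (f v) ≤ w := by
  classical
  let e1 : (Fin k → ZMod 2 × ZMod 2) × (Fin (n - k) → ZMod 2) → PauliVec n := fun p i =>
    if hi : (i : ℕ) < k then p.1 ⟨i, hi⟩ else (0, p.2 ⟨i - k, by omega⟩)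
  let e2 : (Fin w → ZMod 2 × ZMod 2) → PauliVec n := fun p i =>
    if hi : (i : ℕ) < w then p ⟨i, hi⟩ else 0
  have he1 : Function.Injective e1 := by
    rintro ⟨a, b⟩ ⟨a', b'⟩ h
    refine Prod.ext (funext fun i => ?_) (funext fun i => ?_)
    · have := congrFun h ⟨i, by omega⟩
      simpa [e1] using this
    · have := congrFun h ⟨i + k, by omega⟩
      simpa [e1] using this
  have he2 : ∀ p p', e2 p - e2 p' = e2 (p - p') := by
    intro p p'
    funext i
    simp only [e2, Pi.sub_apply]
    split_ifs <;> simp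
  have hmem : ∀ p, e1 p ∈ ancillaNormalizer n k := by
    intro p i hi
    simp [e1, not_lt.mpr hi]
  let F : ((Fin k → ZMod 2 × ZMod 2) × (Fin (n - k) → ZMod 2)) × (Fin w → ZMod 2 × ZMod 2) →
    PauliVec n := fun p => f (e1 p.1) + e2 p.2
  have hcard : Fintype.card (PauliVec n) < Fintype.card
      (((Fin k → ZMod 2 × ZMod 2) × (Fin (n - k) → ZMod 2)) × (Fin w → ZMod 2 × ZMod 2)) := by
    simp only [Fintype.card_prod, Fintype.card_pi, ZMod.card, Finset.prod_const,
      Finset.card_univ, Fintype.card_fin]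
    rw [show 2 * 2 = 2 ^ 2 from rfl, ← pow_mul, ← pow_mul, ← pow_mul, ← pow_add, ← pow_add]
    exact Nat.pow_lt_pow_right (by norm_num) (by omega)
  obtain ⟨⟨a, b⟩, ⟨a', b'⟩, hne, heq⟩ := Fintype.exists_ne_map_eq_of_card_lt F hcard
  have hfsub : ∀ v v', f (v - v') = f v - f v' := fun v v' => by
    rw [eq_sub_iff_add_eq, ← hadd, sub_add_cancel]
  have h1 : f (e1 a - e1 a') = e2 (b' - b) := by
    rw [hfsub, ← he2]
    simp only [F] at heq
    rw [sub_eq_sub_iff_add_eq_add, heq, add_comm]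
  refine ⟨e1 a - e1 a', sub_mem (hmem a) (hmem a'), fun h0 => ?_, ?_⟩
  · have ha : a = a' := he1 (sub_eq_zero.mp h0)
    have hb : b = b' := by
      rw [h0] at h1
      have hf0 : f 0 = 0 := by simpa using hfsub 0 0
      rw [hf0] at h1
      funext i
      have := congrFun h1 ⟨i, by omega⟩
      simp only [Pi.zero_apply, e2, i.2, dif_pos, Pi.sub_apply] at this
      exact (sub_eq_zero.mp this.symm).symm
    exact hne (by rw [ha, hb])
  · rw [h1, vecWeight]
    calc _ ≤ (Finset.univ.filter fun i : Fin n => (i : ℕ) < w).card := by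
          refine Finset.card_le_card fun i => ?_
          simp only [Finset.mem_filter, Finset.mem_univ, true_and, e2]
          intro h
          by_contra hi
          simp [hi] at h
      _ ≤ (Finset.range w).card := Finset.card_le_card_of_injOn (fun i => (i : ℕ))
          (by intro i; simp) (by intro i _ j _ h; exact Fin.ext h)
      _ = w := Finset.card_range w

/-- A circuit is the encoder of a good nondegenerate code as soon as its action on Pauli vectors
maps all nonzero elements of the normalizer of the ancillas to weight at least `d`, and those of
the stabilizer of the ancillas to weight more than about half the number of ancillas. -/
theorem exists_code_of_realizable {n k w d D : ℕ} (hk : k ≤ n) (hw : n < 2 * w + k) (hwn : w ≤ n)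
    {f : PauliVec n → PauliVec n} (hR : Realizable D f) (hf : Function.Bijective f)
    (hadd : ∀ v v', f (v + v') = f v + f v')
    (hN : ∀ v ∈ ancillaNormalizer n k, v ≠ 0 → d ≤ vecWeight (f v))
    (hS : ∀ v ∈ ancillaStabilizer n k, v ≠ 0 → w < vecWeight (f v)) :
    ∃ (C : StabilizerCode n) (E : CliffordCircuit n), C.EncodesQubits k ∧ C.IsNondegenerate ∧
      d ≤ C.minDistance ∧ E.IsEncoder C k ∧ E.depth ≤ D := by
  obtain ⟨E, hD, hU⟩ := hR
  have hf0 : f 0 = 0 := by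
    have := hadd 0 0
    rw [add_zero] at this
    simpa using this
  have hzero : (fun i => pauliIndex (f 0 i)) = (0 : Fin n → Fin 4) := by
    rw [hf0]
    rfl
  obtain ⟨v₀, hv₀, hv₀0, hv₀w⟩ := exists_normalizer_weight_le hk hw hwn hadd
  -- This element also shows that the minimum distance is not an infimum over the empty set.
  have hmem : pauliWeight (fun i => pauliIndex (f v₀ i)) ∈
      {w | ∃ ν : Fin n → Fin 4, (hU.code k).InNormalizer ν ∧ ¬ (hU.code k).InStabilizer ν ∧
        pauliWeight ν = w} := by
    refine ⟨_, (hU.inNormalizer_iff v₀).mpr hv₀, fun h => ?_, rfl⟩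
    obtain ⟨v, hv, hvv⟩ := hU.exists_of_inStabilizer h
    have : f v₀ = f v := by
      funext i
      exact pauliIndex.injective (congrFun hvv i)
    have hvv₀ := hf.1 this
    subst hvv₀
    exact absurd hv₀w (not_le.mpr (hS _ hv hv₀0))
  refine ⟨hU.code k, E, hU.encodesQubits hk, ?_, ?_, ⟨hk, ?_⟩, hD⟩
  · intro ν hν hs
    obtain ⟨v, hv, rfl⟩ := hU.exists_of_inStabilizer hs
    have hv0 : v ≠ 0 := by
      rintro rfl
      exact hν hzero
    have h1 : (hU.code k).minDistance ≤ w := by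
      refine (Nat.sInf_le hmem).trans ?_
      rw [pauliWeight_pauliIndex]
      exact hv₀w
    rw [pauliWeight_pauliIndex]
    exact h1.trans (hS v hv hv0).le
  · refine le_csInf ⟨_, hmem⟩ ?_
    rintro b ⟨ν, hν, hs, rfl⟩
    obtain ⟨v, hv⟩ := hf.2 fun i => pauliIndex.symm (ν i)
    have hνv : ν = fun i => pauliIndex (f v i) := by rw [hv]; simp
    rw [hνv] at hν hs ⊢
    rw [hU.inNormalizer_iff] at hν
    rw [pauliWeight_pauliIndex]
    refine hN v hν ?_
    rintro rfl
    apply hs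
    rw [hzero]
    refine ⟨1, one_mem _, 1, ?_⟩
    rw [pauliString_eq_sigma, one_smul]
    exact sigma_zero.symm
  · rw [hU.codeSpace_eq hk]
    ext u
    simp [withAncillasLinear]

/-! ### The butterfly transform and its uncertainty principle -/

section Butterfly

variable {E : Type*} [AddCommGroup E]

/-- A linear map of `E × E` which is injective and all of whose four entries are injective. -/
structure IsCoupling (g : E × E →+ E × E) : Prop where
  injective : Function.Injective g
  fst_left : ∀ x, (g (x, 0)).1 = 0 → x = 0
  snd_left : ∀ x, (g (x, 0)).2 = 0 → x = 0
  fst_right : ∀ y, (g (0, y)).1 = 0 → y = 0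
  snd_right : ∀ y, (g (0, y)).2 = 0 → y = 0

/-- The component of a pair indexed by a bit. -/
def pairEntry (c : Bool) (p : E × E) : E := if c then p.2 else p.1

/-- The tensor power of the `2 × 2` matrix `g`, acting on `E`-valued functions on the cube. -/
def butterfly (g : E × E →+ E × E) : (a : ℕ) → ((Fin a → Bool) → E) → (Fin a → Bool) → E
  | 0, f => f
  | a + 1, f => fun b => pairEntry (b 0)
      (g (butterfly g a (fun b' => f (Fin.cons false b')) (Fin.tail b),
        butterfly g a (fun b' => f (Fin.cons true b')) (Fin.tail b)))

theorem pairEntry_sub (c : Bool) (p q : E × E) :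
    pairEntry c (p - q) = pairEntry c p - pairEntry c q := by
  cases c <;> rfl

theorem butterfly_sub (g : E × E →+ E × E) (a : ℕ) (f f' : (Fin a → Bool) → E) :
    butterfly g a (f - f') = butterfly g a f - butterfly g a f' := by
  induction a with
  | zero => rfl
  | succ a ih =>
    funext b
    have h : ∀ c, butterfly g a (fun b' => (f - f') (Fin.cons c b')) =
        butterfly g a (fun b' => f (Fin.cons c b')) -
          butterfly g a (fun b' => f' (Fin.cons c b')) := fun c => by
      rw [← ih]; rfl
    simp only [butterfly]
    rw [h, h]
    simp only [Pi.sub_apply, ← pairEntry_sub, ← map_sub, Prod.mk_sub_mk]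

theorem butterfly_zero (g : E × E →+ E × E) (a : ℕ) : butterfly g a 0 = 0 := by
  simpa using butterfly_sub g a 0 0

theorem butterfly_succ_cons (g : E × E →+ E × E) (a : ℕ) (f : (Fin (a + 1) → Bool) → E) (c : Bool)
    (b : Fin a → Bool) : butterfly g (a + 1) f (Fin.cons c b) = pairEntry c
      (g (butterfly g a (fun b' => f (Fin.cons false b')) b,
        butterfly g a (fun b' => f (Fin.cons true b')) b)) := by
  simp [butterfly]

/-- One factor of the tensor power, acting on the coordinate `t` of the cube. -/
def butterflyLevel (g : E × E →+ E × E) {a : ℕ} (t : Fin a) (f : (Fin a → Bool) → E) :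
    (Fin a → Bool) → E :=
  fun b => pairEntry (b t) (g (f (Function.update b t false), f (Function.update b t true)))

theorem butterfly_eq_foldr (g : E × E →+ E × E) (a : ℕ) (f : (Fin a → Bool) → E) :
    butterfly g a f = (List.finRange a).foldr (butterflyLevel g) f := by
  induction a with
  | zero => simp [butterfly]
  | succ a ih =>
    have hl : ∀ (l : List (Fin a)) (f : (Fin (a + 1) → Bool) → E) (c : Bool) (b : Fin a → Bool),
        (l.map Fin.succ).foldr (butterflyLevel g) f (Fin.cons c b) =
          l.foldr (butterflyLevel g) (fun b' => f (Fin.cons c b')) b := by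
      intro l f c
      induction l with
      | nil => intro b; rfl
      | cons t l ihl =>
        intro b
        simp only [List.map_cons, List.foldr_cons, butterflyLevel, Fin.cons_succ,
          ← Fin.cons_update, ihl]
    funext b
    rw [List.finRange_succ, List.foldr_cons]
    simp only [butterfly, ih, butterflyLevel]
    rw [← hl, ← hl]
    have hb : ∀ c, Function.update b 0 c = Fin.cons c (Fin.tail b) := by
      intro c
      conv_lhs => rw [← Fin.cons_self_tail b]
      rw [Fin.update_cons_zero]
    rw [hb, hb]

variable [Fintype E] [DecidableEq E]

/-- The functions supported on `T` whose transform is supported on `S`. -/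
def concentrated (g : E × E →+ E × E) (a : ℕ) (T S : Finset (Fin a → Bool)) :
    Finset ((Fin a → Bool) → E) :=
  Finset.univ.filter fun f => (∀ b, b ∉ T → f b = 0) ∧ ∀ b, b ∉ S → butterfly g a f b = 0

theorem mem_concentrated {g : E × E →+ E × E} {a : ℕ} {T S : Finset (Fin a → Bool)}
    {f : (Fin a → Bool) → E} : f ∈ concentrated g a T S ↔
      (∀ b, b ∉ T → f b = 0) ∧ ∀ b, b ∉ S → butterfly g a f b = 0 := by
  simp [concentrated]

theorem sub_mem_concentrated {g : E × E →+ E × E} {a : ℕ} {T S : Finset (Fin a → Bool)}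
    {f f' : (Fin a → Bool) → E} (h : f ∈ concentrated g a T S) (h' : f' ∈ concentrated g a T S) :
    f - f' ∈ concentrated g a T S := by
  rw [mem_concentrated] at *
  refine ⟨fun b hb => ?_, fun b hb => ?_⟩
  · rw [Pi.sub_apply, h.1 b hb, h'.1 b hb, sub_zero]
  · rw [butterfly_sub, Pi.sub_apply, h.2 b hb, h'.2 b hb, sub_zero]

/-- The restriction of a subset of the cube to a half of the cube. -/
def halfCube {a : ℕ} (T : Finset (Fin (a + 1) → Bool)) (c : Bool) : Finset (Fin a → Bool) :=
  Finset.univ.filter fun b => Fin.cons c b ∈ T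

theorem mem_halfCube {a : ℕ} {T : Finset (Fin (a + 1) → Bool)} {c : Bool} {b : Fin a → Bool} :
    b ∈ halfCube T c ↔ (Fin.cons c b : Fin (a + 1) → Bool) ∈ T := by
  simp [halfCube]

theorem card_halfCube {a : ℕ} (T : Finset (Fin (a + 1) → Bool)) :
    T.card = (halfCube T false).card + (halfCube T true).card := by
  have h : ∀ c, (halfCube T c).card = (T.filter fun b => b 0 = c).card := by
    intro c
    refine Finset.card_bij' (fun b _ => Fin.cons c b) (fun b _ => Fin.tail b) ?_ ?_ ?_ ?_
    · intro b hb
      simpa [mem_halfCube] using hb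
    · intro b hb
      rw [Finset.mem_filter] at hb
      rw [mem_halfCube, ← hb.2, Fin.cons_self_tail]
      exact hb.1
    · intro b _
      rw [Fin.tail_cons]
    · intro b hb
      rw [Finset.mem_filter] at hb
      rw [← hb.2, Fin.cons_self_tail]
  rw [h, h, ← Finset.card_filter_add_card_filter_not (fun b : Fin (a + 1) → Bool => b 0 = false)]
  simp

/-- Restriction to one half of the cube: the transform of the restriction is supported on the
union of the two halves of `S`, and if the restriction to that half vanishes, then that of the
other half is supported on their intersection. -/
theorem card_concentrated_succ_le {g : E × E →+ E × E} (hg : IsCoupling g) (a : ℕ)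
    (T S : Finset (Fin (a + 1) → Bool)) (c : Bool) :
    (concentrated g (a + 1) T S).card ≤
      (concentrated g a (halfCube T !c) (halfCube S false ∩ halfCube S true)).card *
        (concentrated g a (halfCube T c) (halfCube S false ∪ halfCube S true)).card := by
  have hS : ∀ f ∈ concentrated g (a + 1) T S, ∀ (d : Bool) (b : Fin a → Bool),
      b ∉ halfCube S d → pairEntry d (g (butterfly g a (fun b' => f (Fin.cons false b')) b,
        butterfly g a (fun b' => f (Fin.cons true b')) b)) = 0 := by
    intro f hf d b hb
    rw [← butterfly_succ_cons]
    exact (mem_concentrated.mp hf).2 _ fun h => hb (mem_halfCube.mpr h)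
  have hT : ∀ f ∈ concentrated g (a + 1) T S, ∀ (d : Bool) (b : Fin a → Bool),
      b ∉ halfCube T d → f (Fin.cons d b) = 0 := by
    intro f hf d b hb
    exact (mem_concentrated.mp hf).1 _ fun h => hb (mem_halfCube.mpr h)
  refine Finset.card_le_mul_card_image_of_maps_to (f := fun f b => f (Fin.cons c b)) ?_ _ ?_
  · intro f hf
    rw [mem_concentrated]
    refine ⟨fun b hb => hT f hf c b hb, fun b hb => ?_⟩
    rw [Finset.mem_union, not_or] at hb
    have h : g (butterfly g a (fun b' => f (Fin.cons false b')) b,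
        butterfly g a (fun b' => f (Fin.cons true b')) b) = g 0 := by
      rw [map_zero]
      exact Prod.ext (hS f hf false b hb.1) (hS f hf true b hb.2)
    have h' := hg.injective h
    cases c
    · exact congrArg Prod.fst h'
    · exact congrArg Prod.snd h'
  · intro f₁ _
    rcases Finset.eq_empty_or_nonempty ((concentrated g (a + 1) T S).filter
      fun f => (fun b => f (Fin.cons c b)) = f₁) with h | ⟨f₀, hf₀⟩
    · rw [h]; exact Nat.zero_le _
    · rw [Finset.mem_filter] at hf₀
      refine Finset.card_le_card_of_injOn (fun f b => (f - f₀) (Fin.cons (!c) b)) ?_ ?_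
      · intro f hf
        rw [Finset.mem_coe, Finset.mem_filter] at hf
        have hd := sub_mem_concentrated hf.1 hf₀.1
        have hc : (fun b => (f - f₀) (Fin.cons c b)) = 0 := by
          funext b
          have := congrFun (hf.2.trans hf₀.2.symm) b
          simpa [sub_eq_zero] using this
        rw [Finset.mem_coe, mem_concentrated]
        refine ⟨fun b hb => hT _ hd _ b hb, fun b hb => ?_⟩
        rw [Finset.mem_inter, not_and_or] at hb
        have h0 := hS _ hd false b
        have h1 := hS _ hd true b
        cases c
        · rw [hc, butterfly_zero] at h0 h1
          rcases hb with hb | hb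
          · exact hg.fst_right _ (h0 hb)
          · exact hg.snd_right _ (h1 hb)
        · rw [hc, butterfly_zero] at h0 h1
          rcases hb with hb | hb
          · exact hg.fst_left _ (h0 hb)
          · exact hg.snd_left _ (h1 hb)
      · intro f hf f' hf' h
        rw [Finset.mem_coe, Finset.mem_filter] at hf hf'
        funext b
        rw [← Fin.cons_self_tail b]
        by_cases hb : b 0 = c
        · rw [hb]
          exact congrFun (hf.2.trans hf'.2.symm) (Fin.tail b)
        · have hb' : b 0 = !c := Bool.eq_not.mpr hb
          rw [hb']
          have := congrFun h (Fin.tail b)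
          simpa using this

/-- A function and its transform cannot both be concentrated: the functions supported on `T` with
transform supported on `S` form a space of dimension at most `|T| |S| / 2 ^ a`. -/
theorem card_concentrated_pow_le {g : E × E →+ E × E} (hg : IsCoupling g) (a : ℕ)
    (T S : Finset (Fin a → Bool)) :
    (concentrated g a T S).card ^ 2 ^ a ≤ Fintype.card E ^ (T.card * S.card) := by
  have hE : 0 < Fintype.card E := Fintype.card_pos
  induction a with
  | zero =>
    rw [pow_zero, pow_one]
    by_cases h : T = ∅ ∨ S = ∅
    · have : concentrated g 0 T S ⊆ {0} := by
        intro f hf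
        rw [mem_concentrated] at hf
        rw [Finset.mem_singleton]
        funext b
        rcases h with rfl | rfl
        · exact hf.1 b (Finset.notMem_empty b)
        · exact hf.2 b (Finset.notMem_empty b)
      exact (Finset.card_le_card this).trans (Nat.one_le_pow _ _ hE)
    · rw [not_or] at h
      have hT := Finset.card_pos.mpr (Finset.nonempty_iff_ne_empty.mpr h.1)
      have hS := Finset.card_pos.mpr (Finset.nonempty_iff_ne_empty.mpr h.2)
      calc _ ≤ Fintype.card ((Fin 0 → Bool) → E) := Finset.card_le_univ _
        _ = Fintype.card E ^ 1 := by simp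
        _ ≤ _ := Nat.pow_le_pow_right hE (Nat.mul_pos hT hS)
  | succ a ih =>
    have h0 := Nat.pow_le_pow_left (card_concentrated_succ_le hg a T S false) (2 ^ a)
    have h1 := Nat.pow_le_pow_left (card_concentrated_succ_le hg a T S true) (2 ^ a)
    rw [mul_pow] at h0 h1
    have hS := Finset.card_union_add_card_inter (halfCube S false) (halfCube S true)
    rw [pow_succ 2 a, pow_mul, sq, card_halfCube T, card_halfCube S]
    refine (Nat.mul_le_mul (h0.trans (Nat.mul_le_mul (ih _ _) (ih _ _)))
      (h1.trans (Nat.mul_le_mul (ih _ _) (ih _ _)))).trans (le_of_eq ?_)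
    rw [← pow_add, ← pow_add, ← pow_add, ← hS]
    congr 1
    simp only [Bool.not_false, Bool.not_true]
    ring

/-- The functions supported on `T` whose transform vanishes at the points `z i`. -/
def vanishing (g : E × E →+ E × E) (a : ℕ) (T : Finset (Fin a → Bool)) {r : ℕ}
    (z : Fin r → Fin a → Bool) : Finset ((Fin a → Bool) → E) :=
  Finset.univ.filter fun f => (∀ b, b ∉ T → f b = 0) ∧ ∀ i, butterfly g a f (z i) = 0

theorem mem_vanishing {g : E × E →+ E × E} {a : ℕ} {T : Finset (Fin a → Bool)} {r : ℕ}
    {z : Fin r → Fin a → Bool} {f : (Fin a → Bool) → E} : f ∈ vanishing g a T z ↔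
      (∀ b, b ∉ T → f b = 0) ∧ ∀ i, butterfly g a f (z i) = 0 := by
  simp [vanishing]

theorem card_supported_le {B : Type*} [Fintype B] [DecidableEq B] (T : Finset B) :
    (Finset.univ.filter fun f : B → E => ∀ b, b ∉ T → f b = 0).card ≤
      Fintype.card E ^ T.card := by
  calc _ ≤ Fintype.card (T → E) := by
        refine Finset.card_le_card_of_injOn (t := Finset.univ) (fun f b => f b) (by simp) ?_
        intro f hf f' hf' h
        rw [Finset.mem_coe, Finset.mem_filter] at hf hf'
        replace hf := hf.2
        replace hf' := hf'.2
        funext b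
        by_cases hb : b ∈ T
        · exact congrFun h ⟨b, hb⟩
        · rw [hf b hb, hf' b hb]
    _ = _ := by simp

/-- The vanishing of the transform outside `S` is enforced by few points: choosing them greedily,
each point at least halves the number of functions left. -/
theorem exists_vanishing_eq_concentrated (g : E × E →+ E × E) (a : ℕ)
    (T S : Finset (Fin a → Bool)) {b₀ : Fin a → Bool} (hb₀ : b₀ ∉ S) {l : ℕ}
    (hl : Fintype.card E = 2 ^ l) :
    ∃ z : Fin (l * T.card) → Fin a → Bool, vanishing g a T z = concentrated g a T S := by
  have hsub : ∀ {r : ℕ} (z : Fin r → Fin a → Bool), (∀ i, z i ∉ S) →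
      concentrated g a T S ⊆ vanishing g a T z := by
    intro r z hz f hf
    rw [mem_concentrated] at hf
    exact mem_vanishing.mpr ⟨hf.1, fun i => hf.2 _ (hz i)⟩
  have key : ∀ r : ℕ, ∃ z : Fin r → Fin a → Bool, (∀ i, z i ∉ S) ∧
      (vanishing g a T z = concentrated g a T S ∨
        (vanishing g a T z).card * 2 ^ r ≤ Fintype.card E ^ T.card) := by
    intro r
    induction r with
    | zero =>
      refine ⟨Fin.elim0, fun i => i.elim0, Or.inr ?_⟩
      rw [pow_zero, mul_one]
      refine le_trans (Finset.card_le_card fun f hf => ?_) (card_supported_le T)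
      simpa using (mem_vanishing.mp hf).1
    | succ r ih =>
      obtain ⟨z, hz, h⟩ := ih
      have hcons : ∀ b, vanishing g a T (Fin.cons b z : Fin (r + 1) → Fin a → Bool) ⊆
          vanishing g a T z := by
        intro b f hf
        rw [mem_vanishing] at *
        exact ⟨hf.1, fun i => by simpa using hf.2 i.succ⟩
      have hzS : ∀ b, b ∉ S → ∀ i, (Fin.cons b z : Fin (r + 1) → Fin a → Bool) i ∉ S := by
        intro b hb i
        induction i using Fin.cases with
        | zero => simpa using hb
        | succ i => simpa using hz i
      by_cases heq : vanishing g a T z = concentrated g a T S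
      -- The conditions found so far suffice; the point `b₀` merely fills up the list.
      · refine ⟨Fin.cons b₀ z, hzS b₀ hb₀, Or.inl ?_⟩
        exact (heq ▸ hcons b₀).antisymm (hsub _ (hzS b₀ hb₀))
      · have h := h.resolve_left heq
        obtain ⟨f, hf, hf'⟩ : ∃ f ∈ vanishing g a T z, f ∉ concentrated g a T S := by
          by_contra hcon
          push Not at hcon
          exact heq (Finset.Subset.antisymm hcon (hsub z hz))
        have hfT := (mem_vanishing.mp hf).1
        obtain ⟨b, hb, hfb⟩ : ∃ b, b ∉ S ∧ butterfly g a f b ≠ 0 := by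
          by_contra hcon
          push Not at hcon
          exact hf' (mem_concentrated.mpr ⟨hfT, hcon⟩)
        refine ⟨Fin.cons b z, hzS b hb, Or.inr (le_trans ?_ h)⟩
        rw [pow_succ', ← mul_assoc]
        refine Nat.mul_le_mul_right _ ?_
        -- The functions that vanish also at `b` and their translates by `f` are disjoint sets.
        let V := vanishing g a T (Fin.cons b z : Fin (r + 1) → Fin a → Bool)
        have hVz : ∀ f' ∈ V, butterfly g a f' b = 0 := fun f' h' => by
          simpa using (mem_vanishing.mp h').2 0
        have hdisj : Disjoint V (V.image fun f' => f' - f) := by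
          rw [Finset.disjoint_left]
          intro f' h1 h2
          obtain ⟨f'', h3, rfl⟩ := Finset.mem_image.mp h2
          have h4 := hVz _ h1
          rw [butterfly_sub, Pi.sub_apply, hVz _ h3, zero_sub, neg_eq_zero] at h4
          exact hfb h4
        have hsubset : V ∪ V.image (fun f' => f' - f) ⊆ vanishing g a T z := by
          refine Finset.union_subset (hcons b) fun f' h2 => ?_
          obtain ⟨f'', h3, rfl⟩ := Finset.mem_image.mp h2
          have h3' := mem_vanishing.mp (hcons b h3)
          rw [mem_vanishing] at hf ⊢
          refine ⟨fun b hb => ?_, fun i => ?_⟩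
          · rw [Pi.sub_apply, h3'.1 b hb, hf.1 b hb, sub_zero]
          · rw [butterfly_sub, Pi.sub_apply, h3'.2 i, hf.2 i, sub_zero]
        have h5 := Finset.card_le_card hsubset
        rw [Finset.card_union_of_disjoint hdisj,
          Finset.card_image_of_injective _ sub_left_injective] at h5
        change V.card * 2 ≤ _
        omega
  obtain ⟨z, hz, h⟩ := key (l * T.card)
  refine ⟨z, ?_⟩
  rcases h with h | h
  · exact h
  · rw [hl, ← pow_mul] at h
    have h1 : (vanishing g a T z).card ≤ 1 :=
      Nat.le_of_mul_le_mul_right (by rwa [one_mul]) (by positivity)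
    refine Finset.Subset.antisymm (fun f hf => ?_) (hsub z hz)
    have h0 : (0 : (Fin a → Bool) → E) ∈ vanishing g a T z := by
      rw [mem_vanishing, butterfly_zero]
      simp
    rw [Finset.card_le_one.mp h1 f hf 0 h0, mem_concentrated, butterfly_zero]
    simp

end Butterfly

/-! ### A circuit for the butterfly transform -/

/-- The Pauli vectors of a site, which consists of two qubits. -/
abbrev SiteVec : Type := (ZMod 2 × ZMod 2) × (ZMod 2 × ZMod 2)

/-- The component of a site vector at one of the two qubits. -/
def siteEntry (e : Bool) (x : SiteVec) : ZMod 2 × ZMod 2 := if e then x.2 else x.1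

/-- The site vector with the component `p` at the qubit `e` and `0` at the other one. -/
def sitePut (e : Bool) (p : ZMod 2 × ZMod 2) : SiteVec := if e then (0, p) else (p, 0)

theorem siteEntry_add (e : Bool) (x y : SiteVec) :
    siteEntry e (x + y) = siteEntry e x + siteEntry e y := by
  cases e <;> rfl

/-- The transvection on two sites by the string with the component `p` at the qubit `e₀` of the
first site and `q` at the qubit `e₁` of the second one. -/
def pairTransvection (e₀ e₁ : Bool) (p q : ZMod 2 × ZMod 2) :
    SiteVec × SiteVec →+ SiteVec × SiteVec :=
  AddMonoidHom.mk' (fun x => x + (symp (siteEntry e₀ x.1) p + symp (siteEntry e₁ x.2) q) •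
    (sitePut e₀ p, sitePut e₁ q)) (by
      intro x y
      simp only [Prod.fst_add, Prod.snd_add, siteEntry_add, symp_add_left, add_smul]
      abel)

/-- The coupling of two sites: a product of four two-qubit transvections, by `Z ⊗ X`, `Y ⊗ Y`,
`Z ⊗ Z` and `X ⊗ X` on suitable qubits. No two-qubit Clifford gate couples single qubits in this
way, which is why sites have two qubits. -/
def siteCoupling : SiteVec × SiteVec →+ SiteVec × SiteVec :=
  (pairTransvection false false (1, 0) (1, 0)).comp
    ((pairTransvection true false (0, 1) (0, 1)).comp
      ((pairTransvection true true (1, 1) (1, 1)).comp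
        (pairTransvection false true (0, 1) (1, 0))))

set_option maxRecDepth 100000 in
theorem isCoupling_siteCoupling : IsCoupling siteCoupling where
  injective := by
    rw [injective_iff_map_eq_zero]
    decide
  fst_left := by decide
  snd_left := by decide
  fst_right := by decide
  snd_right := by decide

theorem butterflyLevel_comp {E : Type*} [AddCommGroup E] (g g' : E × E →+ E × E) {a : ℕ}
    (t : Fin a) (f : (Fin a → Bool) → E) :
    butterflyLevel g t (butterflyLevel g' t f) = butterflyLevel (g.comp g') t f := by
  funext b
  simp [butterflyLevel, pairEntry]

/-- A partition of `n` qubits into blocks indexed by the cube `Fin a → Bool`, together with `P`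
disjoint pairs of qubits, the sites, in every block. -/
structure BlockLayout (n a P : ℕ) where
  block : Fin n → Fin a → Bool
  site : Fin P × Bool → (Fin a → Bool) → Fin n
  block_site : ∀ x b, block (site x b) = b
  site_injective : ∀ b, Function.Injective fun x => site x b

namespace BlockLayout

variable {n a P : ℕ} (Λ : BlockLayout n a P)

theorem uncurry_site_injective :
    Function.Injective fun x : (Fin P × Bool) × (Fin a → Bool) => Λ.site x.1 x.2 := by
  rintro ⟨x, b⟩ ⟨x', b'⟩ h
  have hb : b = b' := by rw [← Λ.block_site x b, ← Λ.block_site x' b']; exact congrArg _ h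
  subst hb
  exact Prod.ext (Λ.site_injective b h) rfl

/-- The position of a qubit among the sites, if it belongs to one. -/
noncomputable def decode : Fin n → Option ((Fin P × Bool) × (Fin a → Bool)) :=
  Function.partialInv fun x : (Fin P × Bool) × (Fin a → Bool) => Λ.site x.1 x.2

theorem decode_eq_some {i : Fin n} {x : (Fin P × Bool) × (Fin a → Bool)} :
    Λ.decode i = some x ↔ Λ.site x.1 x.2 = i :=
  Λ.uncurry_site_injective.isPartialInv x i

theorem decode_site (x : Fin P × Bool) (b : Fin a → Bool) :
    Λ.decode (Λ.site x b) = some (x, b) := Λ.decode_eq_some.mpr rfl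

/-- The restriction of a Pauli vector to the `j`-th sites of all blocks. -/
def read (j : Fin P) (v : PauliVec n) (b : Fin a → Bool) : SiteVec :=
  (v (Λ.site (j, false) b), v (Λ.site (j, true) b))

theorem siteEntry_read (j : Fin P) (v : PauliVec n) (b : Fin a → Bool) (e : Bool) :
    siteEntry e (Λ.read j v b) = v (Λ.site (j, e) b) := by
  cases e <;> rfl

/-- The colouring for the level `t` of the butterfly: the `j`-th sites of two blocks that differ
only in the coordinate `t` form a class. -/
noncomputable def levelClass (t : Fin a) (i : Fin n) : Option (Fin P × (Fin a → Bool)) :=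
  (Λ.decode i).map fun x => (x.1.1, Function.update x.2 t false)

/-- The Pauli vector that has the component `p` at the qubits `e₀` of the lower sites, and `q` at
the qubits `e₁` of the upper sites, for the coordinate `t`. -/
noncomputable def levelVec (t : Fin a) (e₀ e₁ : Bool) (p q : ZMod 2 × ZMod 2) : PauliVec n :=
  fun i => (Λ.decode i).elim 0 fun x =>
    if x.2 t then (if x.1.2 = e₁ then q else 0) else if x.1.2 = e₀ then p else 0

theorem levelClass_site (t : Fin a) (j : Fin P) (e : Bool) (b : Fin a → Bool) :
    Λ.levelClass t (Λ.site (j, e) b) = some (j, Function.update b t false) := by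
  simp [levelClass, decode_site]

theorem levelVec_site (t : Fin a) (e₀ e₁ : Bool) (p q : ZMod 2 × ZMod 2) (j : Fin P) (e : Bool)
    (b : Fin a → Bool) : Λ.levelVec t e₀ e₁ p q (Λ.site (j, e) b) =
      if b t then (if e = e₁ then q else 0) else if e = e₀ then p else 0 := by
  simp [levelVec, decode_site]

theorem levelVec_eq_zero (t : Fin a) (e₀ e₁ : Bool) (p q : ZMod 2 × ZMod 2) (j : Fin P)
    (b : Fin a → Bool) {l : Fin n} (hl : Λ.levelClass t l = some (j, Function.update b t false))
    (h0 : l ≠ Λ.site (j, e₀) (Function.update b t false))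
    (h1 : l ≠ Λ.site (j, e₁) (Function.update b t true)) :
    Λ.levelVec t e₀ e₁ p q l = 0 := by
  rw [levelClass, Option.map_eq_some_iff] at hl
  obtain ⟨⟨⟨j', e⟩, b'⟩, hx, hxe⟩ := hl
  rw [decode_eq_some] at hx
  simp only [Prod.mk.injEq] at hx hxe
  obtain ⟨rfl, hb⟩ := hxe
  have hb' : ∀ c, Function.update b' t c = Function.update b t c := by
    intro c
    have := congrArg (fun f => Function.update f t c) hb
    simpa using this
  rw [← hx, levelVec_site]
  rcases hc : b' t with _ | _
  · have : b' = Function.update b t false := by rw [← hb', ← hc, Function.update_eq_self]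
    rw [if_neg (by simp), if_neg]
    rintro rfl
    exact h0 (by rw [← hx, this])
  · have : b' = Function.update b t true := by rw [← hb', ← hc, Function.update_eq_self]
    rw [if_pos rfl, if_neg]
    rintro rfl
    exact h1 (by rw [← hx, this])

theorem site_lower_ne_upper (t : Fin a) (x x' : Fin P × Bool) (b : Fin a → Bool) :
    Λ.site x (Function.update b t false) ≠ Λ.site x' (Function.update b t true) := by
  intro h
  have h1 := congrArg Λ.block h
  rw [block_site, block_site] at h1
  simpa using congrFun h1 t

theorem realizable_level (t : Fin a) (e₀ e₁ : Bool) (p q : ZMod 2 × ZMod 2) :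
    Realizable 1 (parTransvection (Λ.levelClass t) (Λ.levelVec t e₀ e₁ p q)) := by
  refine realizable_layer _ _ fun c hc => ?_
  obtain ⟨i, rfl, hi⟩ := hc
  rcases hd : Λ.decode i with _ | ⟨⟨j, e⟩, b⟩
  · simp [levelVec, hd] at hi
  · have hc : Λ.levelClass t i = some (j, Function.update b t false) := by simp [levelClass, hd]
    refine ⟨Λ.site (j, e₀) (Function.update b t false), Λ.site (j, e₁) (Function.update b t true),
      Λ.site_lower_ne_upper t _ _ b, ?_, ?_, fun l hl h0 h1 => ?_⟩
    · rw [levelClass_site, hc, Function.update_idem]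
    · rw [levelClass_site, hc, Function.update_idem]
    · rw [hc] at hl
      exact Λ.levelVec_eq_zero t e₀ e₁ p q j b hl h0 h1

theorem read_level (t : Fin a) (e₀ e₁ : Bool) (p q : ZMod 2 × ZMod 2) (j : Fin P)
    (v : PauliVec n) :
    Λ.read j (parTransvection (Λ.levelClass t) (Λ.levelVec t e₀ e₁ p q) v) =
      butterflyLevel (pairTransvection e₀ e₁ p q) t (Λ.read j v) := by
  funext b
  have hs : classSymp (Λ.levelClass t) (some (j, Function.update b t false)) v
      (Λ.levelVec t e₀ e₁ p q) =
      symp (v (Λ.site (j, e₀) (Function.update b t false))) p +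
        symp (v (Λ.site (j, e₁) (Function.update b t true))) q := by
    rw [classSymp, ← Finset.sum_subset
      (s₁ := {Λ.site (j, e₀) (Function.update b t false),
        Λ.site (j, e₁) (Function.update b t true)}),
      Finset.sum_pair (Λ.site_lower_ne_upper t _ _ b)]
    · simp [levelVec_site]
    · intro l hl
      rw [Finset.mem_insert, Finset.mem_singleton] at hl
      rcases hl with rfl | rfl <;> simp [levelClass_site]
    · intro l hl hl'
      rw [Finset.mem_insert, Finset.mem_singleton, not_or] at hl'
      rw [Finset.mem_filter] at hl
      rw [Λ.levelVec_eq_zero t e₀ e₁ p q j b hl.2 hl'.1 hl'.2, symp_zero_right]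
  have hsite : ∀ e, parTransvection (Λ.levelClass t) (Λ.levelVec t e₀ e₁ p q) v
      (Λ.site (j, e) b) = v (Λ.site (j, e) b) +
        (symp (v (Λ.site (j, e₀) (Function.update b t false))) p +
          symp (v (Λ.site (j, e₁) (Function.update b t true))) q) •
        (if b t then (if e = e₁ then q else 0) else if e = e₀ then p else 0) := by
    intro e
    rw [parTransvection_apply, levelClass_site, hs, levelVec_site]
  rw [read, hsite, hsite]
  simp only [butterflyLevel, pairTransvection, AddMonoidHom.mk'_apply, siteEntry_read]
  rcases hc : b t with _ | _
  · have hb : Function.update b t false = b := by rw [← hc, Function.update_eq_self]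
    rw [hb]
    cases e₀ <;> simp [pairEntry, read, sitePut]
  · have hb : Function.update b t true = b := by rw [← hc, Function.update_eq_self]
    rw [hb]
    cases e₁ <;> simp [pairEntry, read, sitePut]

/-- The butterfly transform, applied to the `j`-th sites of all blocks for every `j`, is
implemented by a circuit with four layers per level. -/
theorem exists_realizable_butterfly : ∃ H : PauliVec n → PauliVec n, Realizable (4 * a) H ∧
    Function.Bijective H ∧ (∀ v v', H (v + v') = H v + H v') ∧
    ∀ j v, Λ.read j (H v) = butterfly siteCoupling a (Λ.read j v) := by
  have hbij : ∀ (t : Fin a) (e₀ e₁ : Bool) (p q : ZMod 2 × ZMod 2), Function.Bijective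
      (parTransvection (Λ.levelClass t) (Λ.levelVec t e₀ e₁ p q)) := fun t e₀ e₁ p q =>
    Function.Involutive.bijective fun v => parTransvection_self _ _ v
  have key : ∀ l : List (Fin a), ∃ H : PauliVec n → PauliVec n, Realizable (4 * l.length) H ∧
      Function.Bijective H ∧ (∀ v v', H (v + v') = H v + H v') ∧
      ∀ j v, Λ.read j (H v) = l.foldr (butterflyLevel siteCoupling) (Λ.read j v) := by
    intro l
    induction l with
    | nil => exact ⟨id, Realizable.id, Function.bijective_id, fun _ _ => rfl, fun _ _ => rfl⟩
    | cons t l ih =>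
      obtain ⟨H, h1, h2, h3, h4⟩ := ih
      refine ⟨parTransvection (Λ.levelClass t) (Λ.levelVec t false false (1, 0) (1, 0)) ∘
        parTransvection (Λ.levelClass t) (Λ.levelVec t true false (0, 1) (0, 1)) ∘
        parTransvection (Λ.levelClass t) (Λ.levelVec t true true (1, 1) (1, 1)) ∘
        parTransvection (Λ.levelClass t) (Λ.levelVec t false true (0, 1) (1, 0)) ∘ H,
        ?_, ?_, ?_, ?_⟩
      · refine ((Λ.realizable_level t _ _ _ _).comp ((Λ.realizable_level t _ _ _ _).comp
          ((Λ.realizable_level t _ _ _ _).comp ((Λ.realizable_level t _ _ _ _).comp h1)))).mono ?_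
        rw [List.length_cons]
        omega
      · exact (hbij _ _ _ _ _).comp ((hbij _ _ _ _ _).comp ((hbij _ _ _ _ _).comp
          ((hbij _ _ _ _ _).comp h2)))
      · intro v v'
        simp only [Function.comp, h3, parTransvection_add]
      · intro j v
        simp only [Function.comp, read_level, h4, butterflyLevel_comp, List.foldr_cons]
        rfl
  obtain ⟨H, h1, h2, h3, h4⟩ := key (List.finRange a)
  refine ⟨H, by simpa using h1, h2, h3, fun j v => ?_⟩
  rw [h4, butterfly_eq_foldr]

end BlockLayout

/-! ### Random products of transvections -/

section Mixing

variable {I : Type*} [Fintype I]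

/-- The transvection `v ↦ v + ⟨v, w⟩ w` on the qubits indexed by `I`. -/
def localTransvection (w v : I → ZMod 2 × ZMod 2) : I → ZMod 2 × ZMod 2 :=
  v + (∑ i, symp (v i) (w i)) • w

/-- The product of the transvections by the strings `η 0, η 1, …`, of which the first acts
first. -/
def transvectionWord : (r : ℕ) → (Fin r → I → ZMod 2 × ZMod 2) → (I → ZMod 2 × ZMod 2) →
    I → ZMod 2 × ZMod 2
  | 0, _, v => v
  | r + 1, η, v => transvectionWord r (Fin.tail η) (localTransvection (η 0) v)

theorem localTransvection_zero (w : I → ZMod 2 × ZMod 2) : localTransvection w 0 = 0 := by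
  simp [localTransvection, symp_zero_left]

theorem localTransvection_self (w v : I → ZMod 2 × ZMod 2) :
    localTransvection w (localTransvection w v) = v := by
  have h : ∀ a : ZMod 2, a + a = 0 := by decide
  have hs : ∀ a : ZMod 2, ∑ i, symp ((v + a • w) i) (w i) = ∑ i, symp (v i) (w i) := by
    intro a
    refine Finset.sum_congr rfl fun i _ => ?_
    rw [Pi.add_apply, symp_add_left, Pi.smul_apply]
    rcases eq_zero_or_one a with rfl | rfl
    · rw [zero_smul, symp_zero_left, add_zero]
    · rw [one_smul, symp_self, add_zero]
  unfold localTransvection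
  rw [hs, add_assoc, ← add_smul, h, zero_smul, add_zero]

theorem localTransvection_eq_zero_iff {w v : I → ZMod 2 × ZMod 2} :
    localTransvection w v = 0 ↔ v = 0 := by
  constructor
  · intro h
    rw [← localTransvection_self w v, h, localTransvection_zero]
  · rintro rfl
    exact localTransvection_zero w

theorem transvectionWord_eq_zero_iff {r : ℕ} {η : Fin r → I → ZMod 2 × ZMod 2}
    {v : I → ZMod 2 × ZMod 2} : transvectionWord r η v = 0 ↔ v = 0 := by
  induction r generalizing v with
  | zero => rfl
  | succ r ih => rw [transvectionWord, ih, localTransvection_eq_zero_iff]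

variable [DecidableEq I]

/-- A uniformly random transvection fixes a nonzero vector `v` with probability one half, and maps
it to any other given vector by at most one choice of its string. -/
theorem two_mul_card_localTransvection_le {v : I → ZMod 2 × ZMod 2} (hv : v ≠ 0)
    (u : I → ZMod 2 × ZMod 2) :
    2 * (Finset.univ.filter fun w => localTransvection w v = u).card ≤
      (if v = u then Fintype.card (I → ZMod 2 × ZMod 2) else 0) + 2 := by
  split_ifs with h
  · subst h
    obtain ⟨i, hi⟩ := Function.ne_iff.mp hv
    have hr : ∀ p : ZMod 2 × ZMod 2, p ≠ 0 → ∃ r, symp p r = 1 := by decide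
    obtain ⟨r, hr⟩ := hr _ hi
    let t : I → ZMod 2 × ZMod 2 := Pi.single i r
    have hs : ∀ w, (∑ j, symp (v j) ((w + t) j)) = (∑ j, symp (v j) (w j)) + 1 := by
      intro w
      have ht : ∑ j, symp (v j) (t j) = 1 := by
        rw [Finset.sum_eq_single i]
        · simp [t, hr]
        · intro j _ hj
          simp [t, hj, symp_zero_right]
        · simp
      simp only [Pi.add_apply, symp_add_right, Finset.sum_add_distrib, ht]
    let A := Finset.univ.filter fun w : I → ZMod 2 × ZMod 2 => localTransvection w v = v
    have hA : ∀ w ∈ A, ∑ j, symp (v j) (w j) = 0 := by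
      intro w hw
      rcases eq_zero_or_one (∑ j, symp (v j) (w j)) with h0 | h0
      · exact h0
      · have hw' : localTransvection w v = v := (Finset.mem_filter.mp hw).2
        rw [localTransvection, h0, one_smul, add_eq_left] at hw'
        rw [hw'] at h0
        simp [symp_zero_right] at h0
    have hdisj : Disjoint A (A.image fun w => w + t) := by
      rw [Finset.disjoint_left]
      intro w h1 h2
      obtain ⟨w', h3, rfl⟩ := Finset.mem_image.mp h2
      have h4 := hA _ h1
      rw [hs, hA _ h3] at h4
      exact absurd h4 (by decide)
    have h5 := Finset.card_le_univ (A ∪ A.image fun w => w + t)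
    rw [Finset.card_union_of_disjoint hdisj,
      Finset.card_image_of_injective _ (add_left_injective t)] at h5
    change 2 * A.card ≤ _
    omega
  · have : (Finset.univ.filter fun w => localTransvection w v = u).card ≤ 1 := by
      have key : ∀ w, localTransvection w v = u → w = u - v := by
        intro w hw
        rcases eq_zero_or_one (∑ j, symp (v j) (w j)) with h0 | h0
        · rw [localTransvection, h0, zero_smul, add_zero] at hw
          exact absurd hw h
        · rw [localTransvection, h0, one_smul] at hw
          rw [← hw, add_sub_cancel_left]
      rw [Finset.card_le_one]
      intro w hw w' hw'
      rw [key w (Finset.mem_filter.mp hw).2, key w' (Finset.mem_filter.mp hw').2]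
    omega

/-- After `r` random transvections the probability of having moved nowhere is `2 ^ (-r)`, and
apart from this the distribution is uniform up to a factor of two. -/
theorem card_transvectionWord_le (r : ℕ) {v : I → ZMod 2 × ZMod 2} (hv : v ≠ 0)
    (u : I → ZMod 2 × ZMod 2) :
    ((Finset.univ.filter fun η : Fin r → I → ZMod 2 × ZMod 2 =>
      transvectionWord r η v = u).card : ℝ) ≤
      (Fintype.card (I → ZMod 2 × ZMod 2) : ℝ) ^ r * ((if v = u then (1 / 2) ^ r else 0) +
        (2 - 2 * (1 / 2) ^ r) / Fintype.card (I → ZMod 2 × ZMod 2)) := by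
  set q : ℝ := ((Fintype.card (I → ZMod 2 × ZMod 2) : ℕ) : ℝ) with hq
  have hq0 : 0 < q := by rw [hq]; exact_mod_cast Fintype.card_pos
  induction r generalizing v with
  | zero =>
    by_cases h : v = u
    · simp [transvectionWord, h]
    · simp [transvectionWord, h]
  | succ r ih =>
    have h1 : ((Finset.univ.filter fun η : Fin (r + 1) → I → ZMod 2 × ZMod 2 =>
        transvectionWord (r + 1) η v = u).card : ℝ) =
        ∑ w, ((Finset.univ.filter fun η : Fin r → I → ZMod 2 × ZMod 2 =>
          transvectionWord r η (localTransvection w v) = u).card : ℝ) := by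
      rw [Finset.card_filter]
      push_cast
      rw [← Equiv.sum_comp (Fin.consEquiv fun _ => I → ZMod 2 × ZMod 2), Fintype.sum_prod_type]
      refine Finset.sum_congr rfl fun w _ => ?_
      rw [Finset.card_filter]
      push_cast
      refine Finset.sum_congr rfl fun η _ => ?_
      simp [transvectionWord, Fin.consEquiv]
    have h2 : ∀ w, ((Finset.univ.filter fun η : Fin r → I → ZMod 2 × ZMod 2 =>
        transvectionWord r η (localTransvection w v) = u).card : ℝ) ≤
        q ^ r * ((if localTransvection w v = u then (1 / 2) ^ r else 0) +
          (2 - 2 * (1 / 2) ^ r) / q) :=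
      fun w => ih fun h => hv (localTransvection_eq_zero_iff.mp h)
    have h3 : (2 : ℝ) * (Finset.univ.filter fun w => localTransvection w v = u).card ≤
        (if v = u then q else 0) + 2 := by
      have := two_mul_card_localTransvection_le hv u
      rw [hq]
      exact_mod_cast this
    rw [h1]
    refine (Finset.sum_le_sum fun w _ => h2 w).trans ?_
    rw [← Finset.mul_sum, Finset.sum_add_distrib, Finset.sum_const, ← Finset.sum_filter,
      Finset.sum_const, Finset.card_univ, nsmul_eq_mul, nsmul_eq_mul, ← hq, pow_succ q, mul_assoc]
    refine mul_le_mul_of_nonneg_left ?_ (by positivity)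
    have h4 : q * ((if v = u then (1 / 2 : ℝ) ^ (r + 1) else 0) +
        (2 - 2 * (1 / 2) ^ (r + 1)) / q) =
        (1 / 2) ^ r * (((if v = u then q else 0) + 2) / 2) + (2 - 2 * (1 / 2) ^ r) := by
      split_ifs <;> field_simp <;> ring
    rw [h4, mul_div_cancel₀ _ hq0.ne']
    have h5 : (0 : ℝ) ≤ (1 / 2) ^ r := by positivity
    nlinarith

end Mixing

/-! ### Mixing the blocks of a partition -/

section BlockMixing

variable {n : ℕ} {B : Type*} [DecidableEq B] (blk : Fin n → B)

/-- The restriction of a Pauli vector to a block. -/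
def blockRestrict (b : B) (v : PauliVec n) : {i // blk i = b} → ZMod 2 × ZMod 2 := fun i => v i

/-- A choice of `r` Pauli strings in every block. -/
abbrev MixData (r : ℕ) : Type _ := ∀ b : B, Fin r → {i // blk i = b} → ZMod 2 × ZMod 2

/-- Every block undergoes the product of the transvections chosen for it. -/
def blockMix (r : ℕ) (ω : MixData blk r) (v : PauliVec n) : PauliVec n :=
  fun i => transvectionWord r (ω (blk i)) (blockRestrict blk (blk i) v) ⟨i, rfl⟩

theorem blockRestrict_blockMix (r : ℕ) (ω : MixData blk r) (v : PauliVec n) (b : B) :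
    blockRestrict blk b (blockMix blk r ω v) =
      transvectionWord r (ω b) (blockRestrict blk b v) := by
  funext ⟨i, hi⟩
  subst hi
  rfl

/-- The first letter of a choice of Pauli strings in the blocks, as a string on all qubits. -/
def MixData.head {blk : Fin n → B} {r : ℕ} (ω : MixData blk (r + 1)) : PauliVec n :=
  fun i => ω (blk i) 0 ⟨i, rfl⟩

theorem MixData.head_apply {B : Type*} {blk : Fin n → B} {r : ℕ} (ω : MixData blk (r + 1))
    {b : B} {l : Fin n} (hl : blk l = b) : ω.head l = ω b 0 ⟨l, hl⟩ := by
  subst hl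
  rfl

theorem blockMix_succ (r : ℕ) (ω : MixData blk (r + 1)) :
    blockMix blk (r + 1) ω =
      blockMix blk r (fun b => Fin.tail (ω b)) ∘ parTransvection blk ω.head := by
  funext v i
  simp only [blockMix, transvectionWord, Function.comp]
  congr 1
  funext ⟨j, hj⟩
  simp only [localTransvection, blockRestrict, parTransvection, Pi.add_apply, Pi.smul_apply]
  have hs : classSymp blk (blk j) v ω.head =
      ∑ l : {l // blk l = blk i}, symp (v l) (ω (blk i) 0 l) := by
    rw [classSymp, hj, Finset.sum_subtype (p := fun l => blk l = blk i) _ (by simp)]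
    refine Finset.sum_congr rfl fun l _ => ?_
    obtain ⟨l, hl⟩ := l
    rw [ω.head_apply hl]
  rw [hs, ω.head_apply hj]

theorem blockMix_add (r : ℕ) (ω : MixData blk r) (v v' : PauliVec n) :
    blockMix blk r ω (v + v') = blockMix blk r ω v + blockMix blk r ω v' := by
  induction r generalizing v v' with
  | zero => rfl
  | succ r ih => simp only [blockMix_succ, Function.comp, parTransvection_add, ih]

theorem blockMix_bijective (r : ℕ) (ω : MixData blk r) :
    Function.Bijective (blockMix blk r ω) := by
  induction r with
  | zero => exact Function.bijective_id
  | succ r ih =>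
    rw [blockMix_succ]
    exact (ih _).comp (Function.Involutive.bijective fun v => parTransvection_self _ _ v)

theorem realizable_blockMix {M : ℕ}
    (hM : ∀ b, (Finset.univ.filter fun i => blk i = b).card ≤ M + 1)
    (h2 : ∀ b, 2 ≤ (Finset.univ.filter fun i => blk i = b).card) (r : ℕ) (ω : MixData blk r) :
    Realizable (r * (2 * M + 1)) (blockMix blk r ω) := by
  induction r with
  | zero => exact Realizable.id.mono (Nat.zero_le _)
  | succ r ih =>
    rw [blockMix_succ]
    refine ((ih _).comp (realizable_parTransvection blk M _ (fun c => ?_) fun i _ => ?_)).mono ?_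
    · refine le_trans (Finset.card_le_card fun i => ?_) (hM c)
      simp only [Finset.mem_filter, Finset.mem_univ, true_and]
      exact And.left
    · obtain ⟨j, hj, hji⟩ := Finset.exists_mem_ne (Finset.one_lt_card_iff_nontrivial.mpr
        (Finset.one_lt_card_iff_nontrivial.mp (h2 (blk i)))) i
      exact ⟨j, hji, (Finset.mem_filter.mp hj).2⟩
    · exact le_of_eq (by ring)

theorem card_blockVec (b : B) :
    Fintype.card ({i // blk i = b} → ZMod 2 × ZMod 2) =
      4 ^ (Finset.univ.filter fun i => blk i = b).card := by
  rw [Fintype.card_fun, Fintype.card_subtype, Fintype.card_prod, ZMod.card]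

variable [Fintype B]

/-- The set of blocks on which a Pauli vector is nonzero. -/
def blockSupport (v : PauliVec n) : Finset B :=
  Finset.univ.filter fun b => ∃ i, blk i = b ∧ v i ≠ 0

variable {blk} in
theorem mem_blockSupport {v : PauliVec n} {b : B} :
    b ∈ blockSupport blk v ↔ blockRestrict blk b v ≠ 0 := by
  rw [blockSupport, Finset.mem_filter, Function.ne_iff]
  simp [blockRestrict]

variable {blk} in
theorem apply_eq_zero_of_notMem_blockSupport {v : PauliVec n} {i : Fin n}
    (h : blk i ∉ blockSupport blk v) : v i = 0 := by
  by_contra h'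
  exact h (by simp only [blockSupport, Finset.mem_filter]; exact ⟨Finset.mem_univ _, i, rfl, h'⟩)

variable {blk} in
theorem blockSupport_eq_empty {v : PauliVec n} : blockSupport blk v = ∅ ↔ v = 0 := by
  constructor
  · intro h
    funext i
    exact apply_eq_zero_of_notMem_blockSupport (blk := blk) (by rw [h]; exact Finset.notMem_empty _)
  · rintro rfl
    simp [blockSupport]

theorem blockSupport_blockMix (r : ℕ) (ω : MixData blk r) (v : PauliVec n) :
    blockSupport blk (blockMix blk r ω v) = blockSupport blk v := by
  ext b
  rw [mem_blockSupport, mem_blockSupport, blockRestrict_blockMix, Ne,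
    transvectionWord_eq_zero_iff]

/-- Mixing maps a given vector to a given one with probability at most `4 ^ (1 - m)` for every
block, of size at least `m`, in which the vector is nonzero. -/
theorem card_blockMix_le {m M r : ℕ}
    (hm : ∀ b, m ≤ (Finset.univ.filter fun i => blk i = b).card)
    (hM : ∀ b, (Finset.univ.filter fun i => blk i = b).card ≤ M) (hr : 2 * M ≤ r)
    (v u : PauliVec n) :
    ((Finset.univ.filter fun ω : MixData blk r => blockMix blk r ω v = u).card : ℝ) ≤
      Fintype.card (MixData blk r) * (4 / 4 ^ m) ^ (blockSupport blk v).card := by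
  have hsub : (Finset.univ.filter fun ω : MixData blk r => blockMix blk r ω v = u) ⊆
      Fintype.piFinset fun b => Finset.univ.filter fun η =>
        transvectionWord r η (blockRestrict blk b v) = blockRestrict blk b u := by
    intro ω hω
    rw [Finset.mem_filter] at hω
    rw [Fintype.mem_piFinset]
    intro b
    rw [Finset.mem_filter, ← blockRestrict_blockMix, hω.2]
    exact ⟨Finset.mem_univ _, rfl⟩
  have h1 : ∀ b, ((Finset.univ.filter fun η : Fin r → {i // blk i = b} → ZMod 2 × ZMod 2 =>
      transvectionWord r η (blockRestrict blk b v) = blockRestrict blk b u).card : ℝ) ≤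
      Fintype.card (Fin r → {i // blk i = b} → ZMod 2 × ZMod 2) *
        (if b ∈ blockSupport blk v then 4 / 4 ^ m else 1) := by
    intro b
    split_ifs with hb
    · refine (card_transvectionWord_le r (mem_blockSupport.mp hb) _).trans ?_
      have hc : (Fintype.card (Fin r → {i // blk i = b} → ZMod 2 × ZMod 2) : ℝ) =
          (Fintype.card ({i // blk i = b} → ZMod 2 × ZMod 2) : ℝ) ^ r := by
        rw [Fintype.card_fun, Fintype.card_fin]
        push_cast
        rfl
      rw [hc]
      refine mul_le_mul_of_nonneg_left ?_ (by positivity)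
      set s := (Finset.univ.filter fun i => blk i = b).card with hs
      have hq : (Fintype.card ({i // blk i = b} → ZMod 2 × ZMod 2) : ℝ) = 4 ^ s := by
        rw [card_blockVec]
        push_cast
        rfl
      rw [hq]
      have h4 : ((1 / 2 : ℝ)) ^ r ≤ 1 / 4 ^ s := by
        rw [one_div_pow]
        refine one_div_le_one_div_of_le (by positivity) ?_
        rw [show (4 : ℝ) = 2 ^ 2 by norm_num, ← pow_mul]
        exact pow_le_pow_right₀ (by norm_num) (by have := hM b; omega)
      have h5 : (1 : ℝ) / 4 ^ s ≤ 1 / 4 ^ m :=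
        one_div_le_one_div_of_le (by positivity) (pow_le_pow_right₀ (by norm_num) (hm b))
      have h6 : (0 : ℝ) ≤ (1 / 2) ^ r := by positivity
      have h7 : (2 - 2 * (1 / 2 : ℝ) ^ r) / 4 ^ s ≤ 2 * (1 / 4 ^ s) := by
        rw [div_eq_mul_one_div]
        exact mul_le_mul_of_nonneg_right (by linarith) (by positivity)
      have h8 : (4 : ℝ) / 4 ^ m = 4 * (1 / 4 ^ m) := by rw [div_eq_mul_one_div]
      have h9 : (0 : ℝ) ≤ 1 / 4 ^ m := by positivity
      split_ifs <;> linarith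
    · rw [mul_one]
      exact_mod_cast Finset.card_le_univ _
  calc _ ≤ ((Fintype.piFinset fun b => Finset.univ.filter fun η =>
        transvectionWord r η (blockRestrict blk b v) = blockRestrict blk b u).card : ℝ) := by
        exact_mod_cast Finset.card_le_card hsub
    _ = ∏ b, ((Finset.univ.filter fun η : Fin r → {i // blk i = b} → ZMod 2 × ZMod 2 =>
        transvectionWord r η (blockRestrict blk b v) = blockRestrict blk b u).card : ℝ) := by
        rw [Fintype.card_piFinset]
        push_cast
        rfl
    _ ≤ ∏ b, ((Fintype.card (Fin r → {i // blk i = b} → ZMod 2 × ZMod 2) : ℝ) *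
        (if b ∈ blockSupport blk v then 4 / 4 ^ m else 1)) :=
        Finset.prod_le_prod (fun _ _ => Nat.cast_nonneg _) fun b _ => h1 b
    _ = _ := by
        rw [Finset.prod_mul_distrib, Fintype.card_pi, Finset.prod_ite_mem, Finset.univ_inter,
          Finset.prod_const]
        push_cast
        rfl

end BlockMixing

/-! ### Vectors of small block support -/

section Counting

variable {n : ℕ} {B : Type*} [DecidableEq B]

theorem sum_filter_mem_le {blk : Fin n → B} {c : Fin n → ℕ} {R : ℕ}
    (hR : ∀ b, (∑ i with blk i = b, c i) ≤ R) (T : Finset B) :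
    (∑ i with blk i ∈ T, c i) ≤ R * T.card := by
  rw [← Finset.sum_fiberwise_of_maps_to (s := Finset.univ.filter fun i => blk i ∈ T) (t := T)
    (g := blk) (by simp), mul_comm, ← smul_eq_mul]
  refine Finset.sum_le_card_nsmul _ _ _ fun b _ => le_trans ?_ (hR b)
  refine Finset.sum_le_sum_of_subset fun i => ?_
  simp only [Finset.mem_filter, Finset.mem_univ, true_and]
  exact And.right

theorem card_blockSupport_subset_le [Fintype B] {blk : Fin n → B}
    {A : Fin n → Finset (ZMod 2 × ZMod 2)} {c : Fin n → ℕ} (hA : ∀ i, (A i).card ≤ 2 ^ c i) {R : ℕ}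
    (hR : ∀ b, (∑ i with blk i = b, c i) ≤ R) (T : Finset B) :
    (Finset.univ.filter fun v : PauliVec n => (∀ i, v i ∈ A i) ∧ blockSupport blk v ⊆ T).card ≤
      (2 ^ R) ^ T.card := by
  calc _ ≤ (Fintype.piFinset fun i => if blk i ∈ T then A i else {0}).card := by
        refine Finset.card_le_card fun v hv => ?_
        rw [Finset.mem_filter] at hv
        rw [Fintype.mem_piFinset]
        intro i
        split_ifs with hi
        · exact hv.2.1 i
        · rw [Finset.mem_singleton]
          exact apply_eq_zero_of_notMem_blockSupport fun h => hi (hv.2.2 h)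
    _ = ∏ i, (if blk i ∈ T then A i else {0}).card := Fintype.card_piFinset _
    _ ≤ ∏ i, 2 ^ (if blk i ∈ T then c i else 0) := by
        refine Finset.prod_le_prod' fun i _ => ?_
        split_ifs
        · exact hA i
        · simp
    _ = 2 ^ ∑ i with blk i ∈ T, c i := by
        rw [Finset.prod_pow_eq_pow_sum, Finset.sum_filter]
    _ ≤ _ := by
        rw [← pow_mul]
        exact Nat.pow_le_pow_right (by norm_num) (sum_filter_mem_le hR T)

end Counting

namespace BlockLayout

variable {n a P : ℕ} (Λ : BlockLayout n a P)

theorem card_decode_eq_none_le {x : ℕ}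
    (hx : ∀ b, (Finset.univ.filter fun i => Λ.block i = b).card ≤ 2 * P + x) (b : Fin a → Bool) :
    (Finset.univ.filter fun i => Λ.block i = b ∧ Λ.decode i = none).card ≤ x := by
  have h1 : (Finset.univ.image fun y : Fin P × Bool => Λ.site y b).card = 2 * P := by
    rw [Finset.card_image_of_injective _ (Λ.site_injective b)]
    simp [mul_comm]
  have hdisj : Disjoint (Finset.univ.image fun y : Fin P × Bool => Λ.site y b)
      (Finset.univ.filter fun i => Λ.block i = b ∧ Λ.decode i = none) := by
    rw [Finset.disjoint_left]
    intro i hi hi'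
    obtain ⟨y, -, rfl⟩ := Finset.mem_image.mp hi
    simp [decode_site] at hi'
  have h2 : (Finset.univ.image fun y : Fin P × Bool => Λ.site y b) ∪
      (Finset.univ.filter fun i => Λ.block i = b ∧ Λ.decode i = none) ⊆
      Finset.univ.filter fun i => Λ.block i = b := by
    intro i hi
    rw [Finset.mem_filter]
    rcases Finset.mem_union.mp hi with h | h
    · obtain ⟨y, -, rfl⟩ := Finset.mem_image.mp h
      exact ⟨Finset.mem_univ _, Λ.block_site y b⟩
    · exact ⟨Finset.mem_univ _, (Finset.mem_filter.mp h).2.1⟩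
  have h3 := Finset.card_le_card h2
  rw [Finset.card_union_of_disjoint hdisj, h1] at h3
  have := hx b
  omega

/-- A Pauli vector supported on the blocks in `T` is determined by its restrictions to the sites
and by its components at the few remaining qubits of these blocks. -/
theorem card_read_mem_le {x : ℕ}
    (hx : ∀ b, (Finset.univ.filter fun i => Λ.block i = b).card ≤ 2 * P + x)
    (T : Finset (Fin a → Bool)) (V : Finset ((Fin a → Bool) → SiteVec)) :
    (Finset.univ.filter fun u : PauliVec n =>
      blockSupport Λ.block u ⊆ T ∧ ∀ j, Λ.read j u ∈ V).card ≤
      V.card ^ P * (4 ^ x) ^ T.card := by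
  have h1 : (Finset.univ.filter fun i => Λ.block i ∈ T ∧ Λ.decode i = none).card ≤
      x * T.card := by
    have := sum_filter_mem_le (blk := Λ.block) (c := fun i => if Λ.decode i = none then 1 else 0)
      (R := x) (fun b => by
        rw [← Finset.sum_filter, Finset.filter_filter, Finset.sum_const, smul_eq_mul, mul_one]
        exact Λ.card_decode_eq_none_le hx b) T
    rwa [← Finset.sum_filter, Finset.filter_filter, Finset.sum_const, smul_eq_mul, mul_one] at this
  calc _ ≤ ((Fintype.piFinset fun _ : Fin P => V) ×ˢ (Finset.univ :
        Finset ({i // Λ.block i ∈ T ∧ Λ.decode i = none} → ZMod 2 × ZMod 2))).card := by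
        refine Finset.card_le_card_of_injOn (fun u => (fun j => Λ.read j u, fun i => u i)) ?_ ?_
        · intro u hu
          rw [Finset.mem_coe, Finset.mem_filter] at hu
          rw [Finset.mem_coe, Finset.mem_product, Fintype.mem_piFinset]
          exact ⟨hu.2.2, Finset.mem_univ _⟩
        · intro u hu u' hu' h
          rw [Finset.mem_coe, Finset.mem_filter] at hu hu'
          rw [Prod.mk.injEq] at h
          funext i
          by_cases hi : Λ.block i ∈ T
          · rcases hd : Λ.decode i with _ | ⟨⟨j, e⟩, b⟩
            · exact congrFun h.2 ⟨i, hi, hd⟩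
            · rw [decode_eq_some] at hd
              have h3 := congrArg (fun f => siteEntry e (f b)) (congrFun h.1 j)
              simp only [siteEntry_read] at h3
              rw [← hd]
              exact h3
          · rw [apply_eq_zero_of_notMem_blockSupport fun h => hi (hu.2.1 h),
              apply_eq_zero_of_notMem_blockSupport fun h => hi (hu'.2.1 h)]
    _ = V.card ^ P * 4 ^ (Finset.univ.filter fun i => Λ.block i ∈ T ∧ Λ.decode i = none).card := by
        rw [Finset.card_product, Fintype.card_piFinset, Finset.prod_const, Finset.card_univ,
          Fintype.card_fin, Finset.card_univ, Fintype.card_fun, Fintype.card_subtype,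
          Fintype.card_prod, ZMod.card]
    _ ≤ _ := by
        rw [← pow_mul]
        exact Nat.mul_le_mul_left _ (Nat.pow_le_pow_right (by norm_num) h1)

/-- The vectors with block support `T` that the butterfly transform maps to vectors supported on a
fraction `1 / D` of the blocks are few: by the uncertainty principle they make up a proportion of
about `4 ^ (- (1 - 1 / D) 2 P |T|)`, up to the number of choices of `4 |T|` witnesses. -/
theorem card_butterfly_le {H : PauliVec n → PauliVec n}
    (hH : ∀ j v, Λ.read j (H v) = butterfly siteCoupling a (Λ.read j v)) {x s D Q : ℕ}
    (hx : ∀ b, (Finset.univ.filter fun i => Λ.block i = b).card ≤ 2 * P + x)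
    (hs : 2 ^ a = D * s) (hD : 2 ≤ D) (hP : P = D * Q) (T : Finset (Fin a → Bool)) :
    (Finset.univ.filter fun u => blockSupport Λ.block u = T ∧
      (blockSupport Λ.block (H u)).card ≤ s).card ≤
      ((2 ^ a) ^ 4 * 16 ^ Q * 4 ^ x) ^ T.card := by
  have hs0 : 0 < s := by
    rcases Nat.eq_zero_or_pos s with h | h
    · rw [h, mul_zero] at hs
      exact absurd hs (by positivity)
    · exact h
  have hsN : s < 2 ^ a := by rw [hs]; nlinarith
  have hE : Fintype.card SiteVec = 2 ^ 4 := by decide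
  let Z : Finset (Fin (4 * T.card) → Fin a → Bool) :=
    Finset.univ.filter fun z => (vanishing siteCoupling a T z).card ^ D ≤ 16 ^ T.card
  have hZ : Z.card ≤ (2 ^ a) ^ (4 * T.card) := by
    refine (Finset.card_le_univ _).trans (le_of_eq ?_)
    simp
  have hsub : (Finset.univ.filter fun u => blockSupport Λ.block u = T ∧
      (blockSupport Λ.block (H u)).card ≤ s) ⊆ Z.biUnion fun z =>
      Finset.univ.filter fun u : PauliVec n => blockSupport Λ.block u ⊆ T ∧
        ∀ j, Λ.read j u ∈ vanishing siteCoupling a T z := by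
    intro u hu
    rw [Finset.mem_filter] at hu
    obtain ⟨-, hT, hS⟩ := hu
    set S := blockSupport Λ.block (H u) with hSdef
    obtain ⟨b₀, hb₀⟩ : ∃ b₀, b₀ ∉ S := by
      by_contra hcon
      push Not at hcon
      have : S = Finset.univ := Finset.eq_univ_iff_forall.mpr hcon
      rw [this, Finset.card_univ] at hS
      simp at hS
      omega
    obtain ⟨z, hz⟩ := exists_vanishing_eq_concentrated siteCoupling a T S hb₀ hE
    rw [Finset.mem_biUnion]
    refine ⟨z, ?_, ?_⟩
    · rw [Finset.mem_filter, hz]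
      refine ⟨Finset.mem_univ _, ?_⟩
      have h1 := card_concentrated_pow_le isCoupling_siteCoupling a T S
      rw [hs, hE, pow_mul, pow_mul] at h1
      have h2 : ((concentrated siteCoupling a T S).card ^ D) ^ s ≤ (16 ^ T.card) ^ s := by
        refine h1.trans ?_
        refine (Nat.pow_le_pow_right (by positivity) hS).trans (le_of_eq ?_)
        norm_num
      exact (Nat.pow_le_pow_iff_left hs0.ne').mp h2
    · rw [Finset.mem_filter]
      refine ⟨Finset.mem_univ _, hT.le, fun j => ?_⟩
      rw [hz, mem_concentrated]
      refine ⟨fun b hb => ?_, fun b hb => ?_⟩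
      · have h0 : ∀ e, u (Λ.site (j, e) b) = 0 := fun e =>
          apply_eq_zero_of_notMem_blockSupport (blk := Λ.block) (by rwa [block_site, hT])
        rw [read, h0, h0]
        rfl
      · have h0 : ∀ e, H u (Λ.site (j, e) b) = 0 := fun e =>
          apply_eq_zero_of_notMem_blockSupport (blk := Λ.block) (by rwa [block_site])
        rw [← hH, read, h0, h0]
        rfl
  calc _ ≤ _ := Finset.card_le_card hsub
    _ ≤ Z.card * ((16 ^ Q) ^ T.card * (4 ^ x) ^ T.card) := by
        refine Finset.card_biUnion_le_card_mul _ _ _ fun z hz => ?_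
        refine (Λ.card_read_mem_le hx T _).trans (Nat.mul_le_mul_right _ ?_)
        rw [hP, pow_mul]
        refine (Nat.pow_le_pow_left (Finset.mem_filter.mp hz).2 Q).trans (le_of_eq ?_)
        rw [← pow_mul, ← pow_mul, mul_comm]
    _ ≤ (2 ^ a) ^ (4 * T.card) * ((16 ^ Q) ^ T.card * (4 ^ x) ^ T.card) :=
        Nat.mul_le_mul_right _ hZ
    _ = _ := by rw [mul_pow, mul_pow, pow_mul (2 ^ a) 4, mul_assoc]

end BlockLayout

/-! ### Union bounds -/

theorem one_add_pow_sub_one_le {N : ℕ} {x : ℝ} (hx0 : 0 ≤ x) (hx : 4 * N * x ≤ 1) :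
    (1 + x) ^ N - 1 ≤ 1 / 3 := by
  rcases Nat.eq_zero_or_pos N with rfl | hN
  · norm_num
  · have hN1 : (1 : ℝ) ≤ N := by exact_mod_cast hN
    have hx1 : x ≤ 1 := by nlinarith
    have h1 : 1 + (N : ℝ) * -x ≤ (1 + -x) ^ N := one_add_mul_le_pow (by linarith) N
    have h2 : (1 + x) ^ N * (1 + -x) ^ N ≤ 1 := by
      rw [← mul_pow]
      exact pow_le_one₀ (by nlinarith) (by nlinarith)
    have h3 : 0 < (1 + x) ^ N := by positivity
    nlinarith

theorem sum_pow_card_eq {B : Type*} [Fintype B] [DecidableEq B] (x : ℝ) :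
    ∑ T : Finset B, x ^ T.card = (1 + x) ^ Fintype.card B := by
  have := Finset.sum_pow_mul_eq_add_pow x 1 (Finset.univ : Finset B)
  simp only [one_pow, mul_one, Finset.powerset_univ, Finset.card_univ] at this
  rw [this, add_comm]

section UnionBound

variable {n : ℕ} {B : Type*} [Fintype B] [DecidableEq B] {blk : Fin n → B}

/-- With high probability, mixing followed by a map `H` takes no nonzero vector of `W` to a vector
with small block support, if the vectors that `H` maps to such vectors are rare. -/
theorem card_bad_blockSupport_le {r s : ℕ} {κ : ℝ} (hκ0 : 0 ≤ κ)
    (hκ : ∀ v u : PauliVec n,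
      ((Finset.univ.filter fun ω : MixData blk r => blockMix blk r ω v = u).card : ℝ) ≤
        Fintype.card (MixData blk r) * κ ^ (blockSupport blk v).card)
    {W : Set (PauliVec n)} [DecidablePred (· ∈ W)] {H : PauliVec n → PauliVec n} {w h : ℕ}
    (hW : ∀ T, (Finset.univ.filter fun v => v ∈ W ∧ blockSupport blk v ⊆ T).card ≤ w ^ T.card)
    (hH : ∀ T, (Finset.univ.filter fun u => blockSupport blk u = T ∧
      (blockSupport blk (H u)).card ≤ s).card ≤ h ^ T.card)
    (hx : 4 * Fintype.card B * (w * h * κ) ≤ 1) :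
    ((Finset.univ.filter fun ω : MixData blk r => ∃ v ∈ W, v ≠ 0 ∧
      (blockSupport blk (H (blockMix blk r ω v))).card ≤ s).card : ℝ) ≤
      Fintype.card (MixData blk r) * (1 / 3) := by
  let J : Finset (PauliVec n × PauliVec n) := Finset.univ.filter fun p =>
    p.1 ∈ W ∧ p.1 ≠ 0 ∧ blockSupport blk p.2 = blockSupport blk p.1 ∧
      (blockSupport blk (H p.2)).card ≤ s
  have h1 : (Finset.univ.filter fun ω : MixData blk r => ∃ v ∈ W, v ≠ 0 ∧
      (blockSupport blk (H (blockMix blk r ω v))).card ≤ s) ⊆ J.biUnion fun p =>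
      Finset.univ.filter fun ω : MixData blk r => blockMix blk r ω p.1 = p.2 := by
    intro ω hω
    rw [Finset.mem_filter] at hω
    obtain ⟨-, v, hv, hv0, hs⟩ := hω
    rw [Finset.mem_biUnion]
    refine ⟨(v, blockMix blk r ω v), ?_, ?_⟩
    · rw [Finset.mem_filter]
      exact ⟨Finset.mem_univ _, hv, hv0, blockSupport_blockMix blk r ω v, hs⟩
    · rw [Finset.mem_filter]
      exact ⟨Finset.mem_univ _, rfl⟩
  have h2 : ∀ T : Finset B, ((J.filter fun p => blockSupport blk p.1 = T).card : ℝ) ≤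
      (w ^ T.card * h ^ T.card : ℕ) - if T = ∅ then 1 else 0 := by
    intro T
    split_ifs with hT
    · subst hT
      have : (J.filter fun p => blockSupport blk p.1 = ∅) = ∅ := by
        rw [Finset.filter_eq_empty_iff]
        intro p hp hp'
        exact (Finset.mem_filter.mp hp).2.2.1 (blockSupport_eq_empty.mp hp')
      rw [this]
      simp
    · rw [sub_zero]
      norm_cast
      refine le_trans ?_ (Nat.mul_le_mul (hW T) (hH T))
      rw [← Finset.card_product]
      refine Finset.card_le_card fun p hp => ?_
      rw [Finset.mem_filter, Finset.mem_filter] at hp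
      obtain ⟨⟨-, h1, h2, h3, h4⟩, h5⟩ := hp
      rw [Finset.mem_product, Finset.mem_filter, Finset.mem_filter]
      exact ⟨⟨Finset.mem_univ _, h1, h5.le⟩, Finset.mem_univ _, h3.trans h5, h4⟩
  calc _ ≤ ((J.biUnion fun p => Finset.univ.filter fun ω : MixData blk r =>
        blockMix blk r ω p.1 = p.2).card : ℝ) := by exact_mod_cast Finset.card_le_card h1
    _ ≤ ∑ p ∈ J, ((Finset.univ.filter fun ω : MixData blk r =>
        blockMix blk r ω p.1 = p.2).card : ℝ) := by exact_mod_cast Finset.card_biUnion_le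
    _ ≤ ∑ p ∈ J, Fintype.card (MixData blk r) * κ ^ (blockSupport blk p.1).card :=
        Finset.sum_le_sum fun p _ => hκ _ _
    _ = Fintype.card (MixData blk r) * ∑ T : Finset B,
          ((J.filter fun p => blockSupport blk p.1 = T).card : ℝ) * κ ^ T.card := by
        rw [← Finset.mul_sum, ← Finset.sum_fiberwise J fun p => blockSupport blk p.1]
        congr 1
        refine Finset.sum_congr rfl fun T _ => ?_
        rw [← nsmul_eq_mul, ← Finset.sum_const]
        refine Finset.sum_congr rfl fun p hp => ?_
        rw [(Finset.mem_filter.mp hp).2]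
    _ ≤ Fintype.card (MixData blk r) * ((1 + w * h * κ) ^ Fintype.card B - 1) := by
        refine mul_le_mul_of_nonneg_left ?_ (Nat.cast_nonneg _)
        rw [← sum_pow_card_eq]
        have h3 : (∑ T : Finset B, if T = ∅ then (1 : ℝ) else 0) = 1 := by simp
        rw [← h3, ← Finset.sum_sub_distrib]
        refine Finset.sum_le_sum fun T _ => ?_
        refine (mul_le_mul_of_nonneg_right (h2 T) (pow_nonneg hκ0 _)).trans (le_of_eq ?_)
        split_ifs with hT
        · subst hT
          simp
        · push_cast
          rw [mul_pow, mul_pow]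
          ring
    _ ≤ _ := mul_le_mul_of_nonneg_left (one_add_pow_sub_one_le (by positivity) hx)
        (Nat.cast_nonneg _)

/-- In a group of vectors with block supports of size more than `s`, the vectors with block
support `Y` are determined by their restrictions to all but `s` blocks of `Y`. -/
theorem card_blockSupport_eq_le {M s : ℕ}
    (hM : ∀ b, (Finset.univ.filter fun i => blk i = b).card ≤ M) {W : AddSubgroup (PauliVec n)}
    [DecidablePred (· ∈ W)] {G : PauliVec n → PauliVec n}
    (hG : ∀ v v', G (v - v') = G v - G v')
    (hs : ∀ v ∈ W, v ≠ 0 → s < (blockSupport blk (G v)).card) (Y : Finset B) :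
    (Finset.univ.filter fun v => v ∈ W ∧ v ≠ 0 ∧ blockSupport blk (G v) = Y).card * 4 ^ (M * s) ≤
      4 ^ (M * Y.card) := by
  rcases lt_or_ge s Y.card with hY | hY
  -- Two vectors that agree outside `s` blocks differ by a vector with block support of size at
  -- most `s`, which has to vanish.
  · obtain ⟨Y₀, hY₀, hc⟩ := Finset.exists_subset_card_eq hY.le
    have h1 : (Finset.univ.filter fun v => v ∈ W ∧ v ≠ 0 ∧ blockSupport blk (G v) = Y).card ≤
        4 ^ (M * (Y \ Y₀).card) := by
      calc _ ≤ Fintype.card ({i // blk i ∈ Y \ Y₀} → ZMod 2 × ZMod 2) := by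
            rw [← Finset.card_univ]
            refine Finset.card_le_card_of_injOn (fun v i => G v i) (by simp) ?_
            intro v hv v' hv' h
            rw [Finset.mem_coe, Finset.mem_filter] at hv hv'
            by_contra hne
            have h2 := hs _ (sub_mem hv.2.1 hv'.2.1) (sub_ne_zero.mpr hne)
            have h3 : blockSupport blk (G (v - v')) ⊆ Y₀ := by
              intro b hb
              rw [blockSupport, Finset.mem_filter] at hb
              obtain ⟨-, i, rfl, hi⟩ := hb
              by_contra hb
              apply hi
              rw [hG, Pi.sub_apply, sub_eq_zero]
              by_cases hiY : blk i ∈ Y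
              · exact congrFun h ⟨i, Finset.mem_sdiff.mpr ⟨hiY, hb⟩⟩
              · have h4 : G v i = 0 :=
                  apply_eq_zero_of_notMem_blockSupport (blk := blk) (by rwa [hv.2.2.2])
                have h5 : G v' i = 0 :=
                  apply_eq_zero_of_notMem_blockSupport (blk := blk) (by rwa [hv'.2.2.2])
                rw [h4, h5]
            have := Finset.card_le_card h3
            omega
        _ = 4 ^ (Finset.univ.filter fun i => blk i ∈ Y \ Y₀).card := by
            rw [Fintype.card_fun, Fintype.card_subtype, Fintype.card_prod, ZMod.card]
        _ ≤ _ := by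
            refine Nat.pow_le_pow_right (by norm_num) ?_
            have := sum_filter_mem_le (blk := blk) (c := fun _ => 1) (R := M)
              (fun b => by simpa using hM b) (Y \ Y₀)
            simpa using this
    rw [Finset.card_sdiff_of_subset hY₀, hc] at h1
    calc _ ≤ 4 ^ (M * (Y.card - s)) * 4 ^ (M * s) := Nat.mul_le_mul_right _ h1
      _ = 4 ^ (M * Y.card) := by
        rw [← pow_add, ← mul_add, Nat.sub_add_cancel hY.le]
  · have : (Finset.univ.filter fun v => v ∈ W ∧ v ≠ 0 ∧ blockSupport blk (G v) = Y) = ∅ := by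
      rw [Finset.filter_eq_empty_iff]
      rintro v - ⟨hv, hv0, hvY⟩
      have := hs v hv hv0
      rw [hvY] at this
      omega
    rw [this]
    simp

/-- The number of Pauli vectors of weight at most `w`, bounded by means of the generating
function `∑ v, t ^ weight v = (1 + 3 t) ^ n` at `t = 2 ^ (-j)`. -/
theorem card_vecWeight_le (w j : ℕ) :
    ((Finset.univ.filter fun v : PauliVec n => vecWeight v ≤ w).card : ℝ) ≤
      2 ^ (j * w) * (1 + 3 / 2 ^ j) ^ n := by
  have hj1 : (1 / 2 ^ j : ℝ) ≤ 1 := by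
    rw [div_le_one (by positivity)]
    exact one_le_pow₀ (by norm_num)
  have h1 : ∀ v : PauliVec n, ∏ i, (if v i = 0 then (1 : ℝ) else 1 / 2 ^ j) =
      (1 / 2 ^ j) ^ vecWeight v := by
    intro v
    rw [Finset.prod_ite, Finset.prod_const_one, one_mul, Finset.prod_const, vecWeight]
  have h2 : ∑ v : PauliVec n, ∏ i, (if v i = 0 then (1 : ℝ) else 1 / 2 ^ j) =
      (1 + 3 / 2 ^ j) ^ n := by
    have h3 : ∑ p : ZMod 2 × ZMod 2, (if p = 0 then (1 : ℝ) else 1 / 2 ^ j) = 1 + 3 / 2 ^ j := by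
      rw [Finset.sum_ite, Finset.sum_const, Finset.sum_const,
        show (Finset.univ.filter fun p : ZMod 2 × ZMod 2 => p = 0).card = 1 from by decide,
        show (Finset.univ.filter fun p : ZMod 2 × ZMod 2 => ¬p = 0).card = 3 from by decide]
      simp
      ring
    rw [← h3]
    have := Finset.prod_univ_sum (fun _ : Fin n => (Finset.univ : Finset (ZMod 2 × ZMod 2)))
      (fun _ p => if p = 0 then (1 : ℝ) else 1 / 2 ^ j)
    rw [Fintype.piFinset_univ] at this
    rw [← this, Finset.prod_const, Finset.card_univ, Fintype.card_fin]
  rw [← h2, Finset.mul_sum, Finset.card_filter]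
  push_cast
  refine Finset.sum_le_sum fun v _ => ?_
  rw [h1]
  split_ifs with hv
  · have h4 : (1 / 2 ^ j : ℝ) ^ w ≤ (1 / 2 ^ j) ^ vecWeight v :=
      pow_le_pow_of_le_one (by positivity) hj1 hv
    calc (1 : ℝ) = 2 ^ (j * w) * (1 / 2 ^ j) ^ w := by
          rw [pow_mul, ← mul_pow, mul_one_div_cancel (by positivity), one_pow]
      _ ≤ _ := mul_le_mul_of_nonneg_left h4 (by positivity)
  · positivity

theorem one_add_three_div_pow_le {n n' j : ℕ} (hn : n ≤ 2 ^ j * n') :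
    (1 + 3 / 2 ^ j : ℝ) ^ n ≤ 2 ^ (5 * n') := by
  have h1 : (1 + 3 / 2 ^ j : ℝ) ^ 2 ^ j ≤ 2 ^ 5 := by
    calc (1 + 3 / 2 ^ j : ℝ) ^ 2 ^ j ≤ Real.exp (3 / 2 ^ j) ^ 2 ^ j :=
          pow_le_pow_left₀ (by positivity) (by rw [add_comm]; exact Real.add_one_le_exp _) _
      _ = Real.exp 1 ^ 3 := by
          rw [← Real.exp_nat_mul, ← Real.exp_nat_mul]
          congr 1
          push_cast
          field_simp
      _ ≤ 3 ^ 3 := pow_le_pow_left₀ (Real.exp_pos _).le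
          (Real.exp_one_lt_d9.le.trans (by norm_num)) _
      _ ≤ 2 ^ 5 := by norm_num
  calc (1 + 3 / 2 ^ j : ℝ) ^ n ≤ (1 + 3 / 2 ^ j) ^ (2 ^ j * n') :=
        pow_le_pow_right₀ (by rw [le_add_iff_nonneg_right]; positivity) hn
    _ ≤ 2 ^ (5 * n') := by
        rw [pow_mul, pow_mul]
        exact pow_le_pow_left₀ (by positivity) h1 _

/-- With high probability, mixing takes no nonzero vector of a group with large block supports to
a vector of small weight. -/
theorem card_bad_vecWeight_le {m x r s : ℕ}
    (hM : ∀ b, (Finset.univ.filter fun i => blk i = b).card ≤ m + x)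
    (hκ : ∀ v u : PauliVec n,
      ((Finset.univ.filter fun ω : MixData blk r => blockMix blk r ω v = u).card : ℝ) ≤
        Fintype.card (MixData blk r) * (4 / 4 ^ m) ^ (blockSupport blk v).card)
    {W : AddSubgroup (PauliVec n)} {G : PauliVec n → PauliVec n}
    (hG : ∀ v v', G (v - v') = G v - G v')
    (hs : ∀ v ∈ W, v ≠ 0 → s < (blockSupport blk (G v)).card) (w : ℕ) {V : ℕ}
    (hV : ((Finset.univ.filter fun v : PauliVec n => vecWeight v ≤ w).card : ℝ) ≤ 2 ^ V)
    (hexp : (2 * x + 3) * Fintype.card B + V + 2 ≤ 2 * m * s)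
    [DecidablePred fun ω : MixData blk r => ∃ v ∈ W, v ≠ 0 ∧
      vecWeight (blockMix blk r ω (G v)) ≤ w] :
    ((Finset.univ.filter fun ω : MixData blk r => ∃ v ∈ W, v ≠ 0 ∧
      vecWeight (blockMix blk r ω (G v)) ≤ w).card : ℝ) ≤
      Fintype.card (MixData blk r) * (1 / 4) := by
  classical
  let J : Finset (PauliVec n) := Finset.univ.filter fun v => v ∈ W ∧ v ≠ 0
  let L : Finset (PauliVec n) := Finset.univ.filter fun v => vecWeight v ≤ w
  have h1 : (Finset.univ.filter fun ω : MixData blk r => ∃ v ∈ W, v ≠ 0 ∧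
      vecWeight (blockMix blk r ω (G v)) ≤ w) ⊆ (J ×ˢ L).biUnion fun p =>
      Finset.univ.filter fun ω : MixData blk r => blockMix blk r ω (G p.1) = p.2 := by
    intro ω hω
    rw [Finset.mem_filter] at hω
    obtain ⟨-, v, hv, hv0, hs⟩ := hω
    rw [Finset.mem_biUnion]
    refine ⟨(v, blockMix blk r ω (G v)), ?_, ?_⟩
    · rw [Finset.mem_product, Finset.mem_filter, Finset.mem_filter]
      exact ⟨⟨Finset.mem_univ _, hv, hv0⟩, Finset.mem_univ _, hs⟩
    · rw [Finset.mem_filter]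
      exact ⟨Finset.mem_univ _, rfl⟩
  have h2 : ∀ Y : Finset B, ((J.filter fun v => blockSupport blk (G v) = Y).card : ℝ) *
      (4 / 4 ^ m) ^ Y.card ≤ 4 ^ ((x + 1) * Fintype.card B) / 4 ^ (m * s) := by
    intro Y
    have h3 := card_blockSupport_eq_le hM hG hs Y
    have h4 : (J.filter fun v => blockSupport blk (G v) = Y) =
        Finset.univ.filter fun v => v ∈ W ∧ v ≠ 0 ∧ blockSupport blk (G v) = Y := by
      simp only [J, Finset.filter_filter, and_assoc]
    have h5 : ((J.filter fun v => blockSupport blk (G v) = Y).card : ℝ) * 4 ^ ((m + x) * s) ≤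
        4 ^ ((m + x) * Y.card) := by
      rw [h4]
      exact_mod_cast h3
    rw [le_div_iff₀ (by positivity), div_pow, ← pow_mul, mul_div_assoc', div_mul_eq_mul_div,
      div_le_iff₀ (by positivity)]
    have h6 : (4 : ℝ) ^ (m * s) ≤ 4 ^ ((m + x) * s) :=
      pow_le_pow_right₀ (by norm_num) (Nat.mul_le_mul_right _ (Nat.le_add_right _ _))
    have h7 : (4 : ℝ) ^ ((x + 1) * Y.card) ≤ 4 ^ ((x + 1) * Fintype.card B) :=
      pow_le_pow_right₀ (by norm_num) (Nat.mul_le_mul_left _ (Finset.card_le_univ _))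
    calc _ ≤ ((J.filter fun v => blockSupport blk (G v) = Y).card : ℝ) * 4 ^ Y.card *
          4 ^ ((m + x) * s) := mul_le_mul_of_nonneg_left h6 (by positivity)
      _ = (((J.filter fun v => blockSupport blk (G v) = Y).card : ℝ) * 4 ^ ((m + x) * s)) *
          4 ^ Y.card := by ring
      _ ≤ 4 ^ ((m + x) * Y.card) * 4 ^ Y.card :=
          mul_le_mul_of_nonneg_right h5 (by positivity)
      _ = 4 ^ ((x + 1) * Y.card) * 4 ^ (m * Y.card) := by
          rw [← pow_add, ← pow_add]
          congr 1
          ring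
      _ ≤ _ := mul_le_mul_of_nonneg_right h7 (by positivity)
  calc _ ≤ (((J ×ˢ L).biUnion fun p => Finset.univ.filter fun ω : MixData blk r =>
        blockMix blk r ω (G p.1) = p.2).card : ℝ) := by exact_mod_cast Finset.card_le_card h1
    _ ≤ ∑ p ∈ J ×ˢ L, ((Finset.univ.filter fun ω : MixData blk r =>
        blockMix blk r ω (G p.1) = p.2).card : ℝ) := by exact_mod_cast Finset.card_biUnion_le
    _ ≤ ∑ p ∈ J ×ˢ L, Fintype.card (MixData blk r) *
          (4 / 4 ^ m : ℝ) ^ (blockSupport blk (G p.1)).card :=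
        Finset.sum_le_sum fun p _ => hκ _ _
    _ = Fintype.card (MixData blk r) * (L.card * ∑ Y : Finset B,
          ((J.filter fun v => blockSupport blk (G v) = Y).card : ℝ) * (4 / 4 ^ m) ^ Y.card) := by
        rw [← Finset.mul_sum, Finset.sum_product]
        simp only [Finset.sum_const, nsmul_eq_mul]
        rw [← Finset.mul_sum, ← Finset.sum_fiberwise J fun v => blockSupport blk (G v)]
        congr 2
        refine Finset.sum_congr rfl fun Y _ => ?_
        rw [← nsmul_eq_mul, ← Finset.sum_const]
        refine Finset.sum_congr rfl fun p hp => ?_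
        rw [(Finset.mem_filter.mp hp).2]
    _ ≤ Fintype.card (MixData blk r) * (2 ^ V * (2 ^ Fintype.card B *
          (4 ^ ((x + 1) * Fintype.card B) / 4 ^ (m * s)))) := by
        refine mul_le_mul_of_nonneg_left (mul_le_mul hV ?_ ?_ (by positivity))
          (Nat.cast_nonneg _)
        · refine (Finset.sum_le_sum fun Y _ => h2 Y).trans (le_of_eq ?_)
          rw [Finset.sum_const, Finset.card_univ, Fintype.card_finset, nsmul_eq_mul]
          push_cast
          rfl
        · exact Finset.sum_nonneg fun _ _ => by positivity
    _ ≤ _ := by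
        refine mul_le_mul_of_nonneg_left ?_ (Nat.cast_nonneg _)
        rw [mul_div_assoc', mul_div_assoc', div_le_div_iff₀ (by positivity) (by norm_num), one_mul,
          show (4 : ℝ) = 2 ^ 2 by norm_num, ← pow_mul, ← pow_mul, ← pow_add, ← pow_add,
          ← pow_add]
        refine pow_le_pow_right₀ (by norm_num) (le_trans (le_of_eq ?_) (hexp.trans (le_of_eq ?_)))
        · ring
        · ring

end UnionBound

/-! ### The striped layout -/

/-- Qubit `i` belongs to the block with number `i % 2 ^ a`, and the qubits in the places `2 j` and
`2 j + 1` of a block form its `j`-th site. In this way the first `k` qubits are spread evenly over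
the blocks, for every `k`. -/
noncomputable def stripedLayout (n a P : ℕ) (h : 2 * P * 2 ^ a ≤ n) : BlockLayout n a P :=
  let e : (Fin a → Bool) ≃ Fin (2 ^ a) := Fintype.equivFinOfCardEq (by simp)
  { block := fun i => e.symm ⟨i % 2 ^ a, Nat.mod_lt _ (by positivity)⟩
    site := fun x b => ⟨(2 * x.1 + x.2.toNat) * 2 ^ a + e b, by
      have h1 : (2 * (x.1 : ℕ) + x.2.toNat + 1) * 2 ^ a ≤ 2 * P * 2 ^ a := by
        refine Nat.mul_le_mul_right _ ?_
        have := x.2.toNat_le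
        omega
      have := (e b).2
      rw [add_mul, one_mul] at h1
      omega⟩
    block_site := by
      intro x b
      rw [Equiv.symm_apply_eq]
      apply Fin.ext
      simp only
      rw [mul_comm, Nat.mul_add_mod, Nat.mod_eq_of_lt (e b).2]
    site_injective := by
      rintro b ⟨⟨j, hj⟩, c⟩ ⟨⟨j', hj'⟩, c'⟩ hx
      have h1 := congrArg Fin.val hx
      simp only [add_left_inj] at h1
      have h2 := Nat.eq_of_mul_eq_mul_right (by positivity) h1
      have h3 : c.toNat = c'.toNat := by
        have := c.toNat_le
        have := c'.toNat_le
        omega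
      have hc : c = c' := by revert h3; cases c <;> cases c' <;> simp
      have hjj : j = j' := by omega
      subst hc hjj
      rfl }

section Striped

variable {n a P : ℕ} (h : 2 * P * 2 ^ a ≤ n)

theorem stripedLayout_block_eq_iff (i i' : Fin n) :
    (stripedLayout n a P h).block i = (stripedLayout n a P h).block i' ↔
      (i : ℕ) % 2 ^ a = i' % 2 ^ a := by
  simp [stripedLayout]

theorem card_stripedLayout_block_le (b : Fin a → Bool) (lo hi : ℕ) :
    (Finset.univ.filter fun i : Fin n => (stripedLayout n a P h).block i = b ∧
      lo ≤ (i : ℕ) ∧ (i : ℕ) < hi).card ≤ (hi - lo) / 2 ^ a + 1 := by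
  rw [← Finset.card_range ((hi - lo) / 2 ^ a + 1)]
  refine Finset.card_le_card_of_injOn (fun i => ((i : ℕ) - lo) / 2 ^ a) ?_ ?_
  · intro i hi
    rw [Finset.mem_coe, Finset.mem_filter] at hi
    rw [Finset.mem_coe, Finset.mem_range, Nat.lt_succ_iff]
    exact Nat.div_le_div_right (by omega)
  · intro i hi i' hi' hii
    rw [Finset.mem_coe, Finset.mem_filter] at hi hi'
    obtain ⟨-, hb, h1, -⟩ := hi
    obtain ⟨-, hb', h1', -⟩ := hi'
    have hmod := (stripedLayout_block_eq_iff h i i').mp (hb.trans hb'.symm)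
    have hmod' : ((i : ℕ) - lo) % 2 ^ a = (i' - lo) % 2 ^ a := by
      have h2 : (i : ℕ) - lo + lo ≡ i' - lo + lo [MOD 2 ^ a] := by
        rw [Nat.sub_add_cancel h1, Nat.sub_add_cancel h1']
        exact hmod
      exact Nat.ModEq.add_right_cancel' lo h2
    apply Fin.ext
    have h3 := Nat.div_add_mod ((i : ℕ) - lo) (2 ^ a)
    have h4 := Nat.div_add_mod ((i' : ℕ) - lo) (2 ^ a)
    simp only at hii
    rw [hii, hmod'] at h3
    omega

theorem le_card_stripedLayout_block (b : Fin a → Bool) :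
    2 * P ≤ (Finset.univ.filter fun i : Fin n => (stripedLayout n a P h).block i = b).card := by
  have h1 : (Finset.univ.image fun y : Fin P × Bool => (stripedLayout n a P h).site y b).card =
      2 * P := by
    rw [Finset.card_image_of_injective _ ((stripedLayout n a P h).site_injective b)]
    simp [mul_comm]
  rw [← h1]
  refine Finset.card_le_card fun i hi => ?_
  obtain ⟨y, -, rfl⟩ := Finset.mem_image.mp hi
  simp [BlockLayout.block_site]

end Striped

/-! ### The choice of the circuit -/

theorem exists_notMem_of_card_le {Ω : Type*} [Fintype Ω] [Nonempty Ω] {p q : Ω → Prop}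
    [DecidablePred p] [DecidablePred q] {x : ℝ} (hx : x < 1 / 2)
    (hp : ((Finset.univ.filter p).card : ℝ) ≤ Fintype.card Ω * x)
    (hq : ((Finset.univ.filter q).card : ℝ) ≤ Fintype.card Ω * x) : ∃ ω, ¬ p ω ∧ ¬ q ω := by
  classical
  by_contra hcon
  push Not at hcon
  have h1 : (Finset.univ : Finset Ω) ⊆ Finset.univ.filter p ∪ Finset.univ.filter q := by
    intro ω _
    rw [Finset.mem_union, Finset.mem_filter, Finset.mem_filter]
    by_cases h : p ω
    · exact Or.inl ⟨Finset.mem_univ _, h⟩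
    · exact Or.inr ⟨Finset.mem_univ _, hcon ω h⟩
  have h2 := (Finset.card_le_card h1).trans (Finset.card_union_le _ _)
  rw [Finset.card_univ] at h2
  have h3 : (Fintype.card Ω : ℝ) ≤ (Finset.univ.filter p).card + (Finset.univ.filter q).card := by
    exact_mod_cast h2
  have h4 : (0 : ℝ) < Fintype.card Ω := by exact_mod_cast Fintype.card_pos
  nlinarith

theorem sum_block_ancillaNormalizer_le {n a P k : ℕ} (h : 2 * P * 2 ^ a ≤ n) (b : Fin a → Bool) :
    (∑ i with (stripedLayout n a P h).block i = b, if (i : ℕ) < k then 2 else 1) ≤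
      (n / 2 ^ a + 1) + (k / 2 ^ a + 1) := by
  have h1 := card_stripedLayout_block_le h b 0 n
  have h2 := card_stripedLayout_block_le h b 0 k
  have h3 : ∀ i : Fin n, (if (i : ℕ) < k then 2 else 1) = 1 + if (i : ℕ) < k then 1 else 0 := by
    intro i
    split_ifs <;> rfl
  simp only [h3, Finset.sum_add_distrib, Finset.sum_boole, Finset.filter_filter]
  simp only [Nat.zero_le, Fin.is_lt, and_true, true_and, Nat.sub_zero] at h1 h2
  simpa using Nat.add_le_add h1 h2

theorem sum_block_ancillaStabilizer_le {n a P k : ℕ} (h : 2 * P * 2 ^ a ≤ n) (b : Fin a → Bool) :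
    (∑ i with (stripedLayout n a P h).block i = b, if (i : ℕ) < k then 0 else 1) ≤
      (n - k) / 2 ^ a + 1 := by
  have h2 := card_stripedLayout_block_le h b k n
  have h3 : ∀ i : Fin n, (if (i : ℕ) < k then 0 else 1) = if k ≤ (i : ℕ) then 1 else 0 := by
    intro i
    split_ifs <;> first | rfl | omega
  simp only [h3, Finset.sum_boole, Finset.filter_filter]
  simp only [Fin.is_lt, and_true] at h2
  simpa using h2

theorem card_ancillaNormalizer_entry_le (c : Prop) [Decidable c] :
    (Finset.univ.filter fun p : ZMod 2 × ZMod 2 => ¬ c → p.1 = 0).card ≤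
      2 ^ (if c then 2 else 1) := by
  by_cases h : c
  · simp [h]
  · simp only [h, not_false_eq_true, forall_const, if_false]
    decide

theorem card_ancillaStabilizer_entry_le (c : Prop) [Decidable c] :
    (Finset.univ.filter fun p : ZMod 2 × ZMod 2 => p.1 = 0 ∧ (c → p.2 = 0)).card ≤
      2 ^ (if c then 0 else 1) := by
  by_cases h : c
  · simp only [h, forall_const, if_true]
    decide
  · simp only [h, IsEmpty.forall_iff, and_true, if_false]
    decide

theorem union_bound_factor_le {N a R q x m : ℕ} (hN : N = 2 ^ a)
    (h : 5 * a + R + 4 * q + 2 * x + 4 ≤ 2 * m) :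
    4 * (N : ℝ) * ((2 ^ R : ℕ) * ((2 ^ a) ^ 4 * 16 ^ q * 4 ^ x : ℕ) * (4 / 4 ^ m)) ≤ 1 := by
  rw [hN]
  push_cast
  rw [mul_div_assoc', mul_div_assoc', div_le_one (by positivity)]
  have h16 : (16 : ℝ) ^ q = 2 ^ (4 * q) := by rw [pow_mul]; norm_num
  have h4 : (4 : ℝ) ^ x = 2 ^ (2 * x) := by rw [pow_mul]; norm_num
  calc (4 : ℝ) * 2 ^ a * (2 ^ R * ((2 ^ a) ^ 4 * 16 ^ q * 4 ^ x) * 4)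
      = 2 ^ (5 * a + R + 4 * q + 2 * x + 4) := by
        rw [h16, h4]
        ring
    _ ≤ 2 ^ (2 * m) := pow_le_pow_right₀ (by norm_num) h
    _ = 4 ^ m := by rw [show (4 : ℝ) = 2 ^ 2 by norm_num, ← pow_mul]

/-- The arithmetic behind the second mixing, for the normalizer. -/
theorem normalizer_exponent_le {n N M Q : ℕ} (hM : N = 64 * M) (hQ : 200 ≤ Q) (hM0 : 0 < M)
    (hn : n < 128 * N * (Q + 1)) :
    n ≤ 2 ^ 10 * (8 * M * (Q + 1)) ∧
      10 * (n / 2000) + 5 * (8 * M * (Q + 1)) ≤ N * (Q + 1) + 40 * M * (Q + 1) ∧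
      (2 * 128 + 3) * N + (N * (Q + 1) + 40 * M * (Q + 1)) + 2 ≤ 2 * (128 * Q) * M := by
  have h1 : 200 * (10 * (n / 2000)) ≤ n := by omega
  obtain ⟨q, rfl⟩ := Nat.exists_eq_add_of_le hQ
  subst hM
  refine ⟨?_, ?_, ?_⟩
  · norm_num
    linarith
  · linarith
  · nlinarith

/-- The arithmetic behind the second mixing, for the stabilizer. -/
theorem stabilizer_exponent_le {n N M Q : ℕ} (hM : N = 64 * M) (hQ : 200 ≤ Q) (hM0 : 0 < M)
    (hn : n < 128 * N * (Q + 1)) :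
    n ≤ 2 ^ 4 * (8 * N * (Q + 1)) ∧
      4 * (n / 32 + 2) + 5 * (8 * N * (Q + 1)) ≤ 56 * N * (Q + 1) + 8 ∧
      (2 * 128 + 3) * N + (56 * N * (Q + 1) + 8) + 2 ≤ 2 * (128 * Q) * (32 * M) := by
  have h1 : 8 * (4 * (n / 32 + 2)) ≤ n + 64 := by omega
  obtain ⟨q, rfl⟩ := Nat.exists_eq_add_of_le hQ
  subst hM
  refine ⟨?_, ?_, ?_⟩
  · norm_num
    linarith
  · linarith
  · nlinarith

theorem depth_sum_le (a Q : ℕ) :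
    (256 * Q + 256) * (2 * (128 * Q + 127) + 1) +
      (4 * a + (256 * Q + 256) * (2 * (128 * Q + 127) + 1)) ≤
      2 * (256 * (Q + 1)) ^ 2 + 4 * a := by
  nlinarith

/-- For a suitable first mixing, the nonzero vectors of the normalizer are spread over a constant
fraction of the blocks and those of the stabilizer over half of the blocks; for a suitable second
mixing, weights that are linear in the number of qubits result. -/
theorem exists_code_of_params {n a Q M : ℕ} (hM : 2 ^ a = 64 * M) (hQ : 2 * a + 200 ≤ Q)
    (hn : 128 * 2 ^ a * Q ≤ n) (hn' : n < 128 * 2 ^ a * (Q + 1)) :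
    ∃ (C : StabilizerCode n) (E : CliffordCircuit n), C.EncodesQubits (15 * n / 16) ∧
      C.IsNondegenerate ∧ n / 2000 + 1 ≤ C.minDistance ∧ E.IsEncoder C (15 * n / 16) ∧
      E.depth ≤ 2 * (256 * (Q + 1)) ^ 2 + 4 * a := by
  classical
  set N := 2 ^ a with hN
  have hN0 : 0 < N := by positivity
  have hM0 : 0 < M := by omega
  set k := 15 * n / 16 with hk
  have hn4 : 4 ≤ n := by nlinarith
  have hP : 2 * (64 * Q) * 2 ^ a ≤ n := by rw [← hN]; nlinarith
  set Λ := stripedLayout n a (64 * Q) hP with hΛ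
  set blk := Λ.block with hblk
  set r := 256 * Q + 256 with hr
  have hcardB : Fintype.card (Fin a → Bool) = N := by simp [hN]
  have hnN : n / N ≤ 128 * Q + 127 := by
    rw [← Nat.lt_succ_iff, Nat.div_lt_iff_lt_mul hN0]
    nlinarith
  have hkN : k / N ≤ 120 * Q + 119 := by
    rw [← Nat.lt_succ_iff, Nat.div_lt_iff_lt_mul hN0]
    have h1 : 16 * k ≤ 15 * n := by omega
    nlinarith
  have hnkN : (n - k) / N ≤ 8 * Q + 9 := by
    rw [← Nat.lt_succ_iff, Nat.div_lt_iff_lt_mul hN0]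
    have h1 : 16 * (n - k) ≤ n + 15 := by omega
    nlinarith
  -- All blocks have between `128 * Q` and `128 * Q + 128` qubits.
  have hlow : ∀ b, 128 * Q ≤ (Finset.univ.filter fun i => blk i = b).card := by
    intro b
    have := le_card_stripedLayout_block hP b
    rw [← hΛ, ← hblk] at this
    omega
  have hupp : ∀ b, (Finset.univ.filter fun i => blk i = b).card ≤ 128 * Q + 128 := by
    intro b
    have := card_stripedLayout_block_le hP b 0 n
    simp only [Nat.zero_le, Fin.is_lt, and_true, Nat.sub_zero] at this
    rw [← hΛ, ← hblk, ← hN] at this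
    omega
  have hκ := card_blockMix_le blk (r := r) hlow hupp (by omega)
  obtain ⟨H, hHR, hHbij, hHadd, hHread⟩ := Λ.exists_realizable_butterfly
  -- In each block a vector of the normalizer has two free bits for an input qubit and one for an
  -- ancilla, and a vector of the stabilizer one for an ancilla only; since the layout is striped,
  -- these numbers are about `31 / 16` and `1 / 16` of the size of the block.
  have hWN : ∀ T, (Finset.univ.filter fun v => v ∈ (ancillaNormalizer n k : Set (PauliVec n)) ∧
      blockSupport blk v ⊆ T).card ≤ (2 ^ (248 * Q + 248)) ^ T.card := by
    intro T
    refine le_trans (Finset.card_le_card fun v hv => ?_) (card_blockSupport_subset_le (blk := blk)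
      (A := fun i => Finset.univ.filter fun p => ¬ (i : ℕ) < k → p.1 = 0)
      (fun i => card_ancillaNormalizer_entry_le _) (R := 248 * Q + 248) (fun b => ?_) T)
    · rw [Finset.mem_filter] at hv ⊢
      refine ⟨Finset.mem_univ _, fun i => ?_, hv.2.2⟩
      rw [Finset.mem_filter]
      exact ⟨Finset.mem_univ _, fun hi => hv.2.1 i (not_lt.mp hi)⟩
    · have := sum_block_ancillaNormalizer_le (k := k) hP b
      rw [← hΛ, ← hblk, ← hN] at this
      omega
  have hWS : ∀ T, (Finset.univ.filter fun v => v ∈ (ancillaStabilizer n k : Set (PauliVec n)) ∧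
      blockSupport blk v ⊆ T).card ≤ (2 ^ (8 * Q + 10)) ^ T.card := by
    intro T
    refine le_trans (Finset.card_le_card fun v hv => ?_) (card_blockSupport_subset_le (blk := blk)
      (A := fun i => Finset.univ.filter fun p => p.1 = 0 ∧ ((i : ℕ) < k → p.2 = 0))
      (fun i => card_ancillaStabilizer_entry_le _) (R := 8 * Q + 10) (fun b => ?_) T)
    · rw [Finset.mem_filter] at hv ⊢
      refine ⟨Finset.mem_univ _, fun i => ?_, hv.2.2⟩
      rw [Finset.mem_filter]
      exact ⟨Finset.mem_univ _, hv.2.1 i⟩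
    · have := sum_block_ancillaStabilizer_le (k := k) hP b
      rw [← hΛ, ← hblk, ← hN] at this
      omega
  have hx : ∀ b, (Finset.univ.filter fun i => Λ.block i = b).card ≤ 2 * (64 * Q) + 128 := by
    intro b
    have := hupp b
    rw [hblk] at this
    omega
  -- The first mixing: after the butterfly, a positive fraction of the blocks is nonzero for the
  -- normalizer, and half of them for the stabilizer.
  have hbadN := card_bad_blockSupport_le (r := r) (s := M) (by positivity) hκ hWN
    (Λ.card_butterfly_le hHread (D := 64) (Q := Q) hx (by rw [← hN, hM]) (by norm_num) rfl)
    (union_bound_factor_le hcardB (by omega))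
  have hbadS := card_bad_blockSupport_le (r := r) (s := 32 * M) (by positivity) hκ hWS
    (Λ.card_butterfly_le hHread (D := 2) (Q := 32 * Q) hx (by rw [← hN, hM]; ring) (by norm_num)
      (by ring)) (union_bound_factor_le hcardB (by omega))
  obtain ⟨ω₁, hω₁N, hω₁S⟩ := exists_notMem_of_card_le (by norm_num) hbadN hbadS
  push Not at hω₁N hω₁S
  -- The second mixing makes the nonzero blocks nearly uniform, so that a union bound over the
  -- vectors of low weight applies.
  set G : PauliVec n → PauliVec n := H ∘ blockMix blk r ω₁ with hG
  have hGadd : ∀ v v', G (v + v') = G v + G v' := by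
    intro v v'
    simp only [hG, Function.comp, blockMix_add, hHadd]
  have hGsub : ∀ v v', G (v - v') = G v - G v' := by
    intro v v'
    rw [eq_sub_iff_add_eq, ← hGadd, sub_add_cancel]
  have hV : ∀ w j n' V, n ≤ 2 ^ j * n' → j * w + 5 * n' ≤ V →
      ((Finset.univ.filter fun v : PauliVec n => vecWeight v ≤ w).card : ℝ) ≤ 2 ^ V := by
    intro w j n' V hnn hVV
    refine (card_vecWeight_le w j).trans ?_
    refine (mul_le_mul_of_nonneg_left (one_add_three_div_pow_le hnn) (by positivity)).trans ?_
    rw [← pow_add]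
    exact pow_le_pow_right₀ (by norm_num) hVV
  obtain ⟨hN1, hN2, hN3⟩ := normalizer_exponent_le hM (by omega) hM0 hn'
  obtain ⟨hS1, hS2, hS3⟩ := stabilizer_exponent_le hM (by omega) hM0 hn'
  have hbadN' := card_bad_vecWeight_le hupp hκ hGsub (W := ancillaNormalizer n k) (s := M)
    hω₁N (n / 2000) (hV _ _ _ _ hN1 hN2) (by rw [hcardB]; exact hN3)
  have hbadS' := card_bad_vecWeight_le hupp hκ hGsub (W := ancillaStabilizer n k) (s := 32 * M)
    hω₁S (n / 32 + 2) (hV _ _ _ _ hS1 hS2) (by rw [hcardB]; exact hS3)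
  obtain ⟨ω₂, hω₂N, hω₂S⟩ := exists_notMem_of_card_le (by norm_num) hbadN' hbadS'
  push Not at hω₂N hω₂S
  have h2 : ∀ b, 2 ≤ (Finset.univ.filter fun i => blk i = b).card :=
    fun b => le_trans (by omega) (hlow b)
  have hmix : ∀ ω : MixData blk r, Realizable (r * (2 * (128 * Q + 127) + 1)) (blockMix blk r ω) :=
    realizable_blockMix blk hupp h2 r
  have hNw : ∀ v ∈ ancillaNormalizer n k, v ≠ 0 →
      n / 2000 + 1 ≤ vecWeight ((blockMix blk r ω₂ ∘ G) v) :=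
    fun v hv hv0 => by
      rw [Function.comp_apply]
      exact Nat.lt_iff_add_one_le.mp (hω₂N v hv hv0)
  have hSw : ∀ v ∈ ancillaStabilizer n k, v ≠ 0 →
      n / 32 + 2 < vecWeight ((blockMix blk r ω₂ ∘ G) v) :=
    fun v hv hv0 => by
      rw [Function.comp_apply]
      exact hω₂S v hv hv0
  have hR : Realizable (2 * (256 * (Q + 1)) ^ 2 + 4 * a) (blockMix blk r ω₂ ∘ G) := by
    refine ((hmix ω₂).comp (hHR.comp (hmix ω₁))).mono ?_
    rw [hr]
    linarith [depth_sum_le a Q]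
  have hbij : Function.Bijective (blockMix blk r ω₂ ∘ G) :=
    (blockMix_bijective blk r ω₂).comp (hHbij.comp (blockMix_bijective blk r ω₁))
  have hadd : ∀ v v', (blockMix blk r ω₂ ∘ G) (v + v') =
      (blockMix blk r ω₂ ∘ G) v + (blockMix blk r ω₂ ∘ G) v' := by
    intro v v'
    simp only [Function.comp_apply, hGadd, blockMix_add]
  have hkn : k ≤ n := by omega
  have hw : n < 2 * (n / 32 + 2) + k := by omega
  have hwn : n / 32 + 2 ≤ n := by omega
  exact exists_code_of_realizable hkn hw hwn hR hbij hadd hNw hSw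

/-- Every large `n` lies in a range `128 * 2 ^ a * Q ≤ n < 128 * 2 ^ a * (Q + 1)` in which `Q`,
which governs the size of the `2 ^ a` blocks, is of the order of `a`. The largest admissible `a` is
taken. -/
theorem exists_params {n : ℕ} (hn : 128 * 2 ^ 6 * 212 ≤ n) :
    ∃ a Q M : ℕ, 2 ^ a = 64 * M ∧ 2 * a + 200 ≤ Q ∧ 128 * 2 ^ a * Q ≤ n ∧
      n < 128 * 2 ^ a * (Q + 1) ∧ Q + 1 ≤ 72 * a ∧ 2 ^ a ≤ n := by
  set P : ℕ → Prop := fun a => 128 * 2 ^ a * (2 * a + 200) ≤ n with hP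
  have h6 : 6 ≤ Nat.findGreatest P n := Nat.le_findGreatest (by omega) (by simpa [hP] using hn)
  set a := Nat.findGreatest P n with ha
  have hPa : 128 * 2 ^ a * (2 * a + 200) ≤ n :=
    Nat.findGreatest_spec (P := P) (m := 6) (by omega) (by simpa [hP] using hn)
  have hPa' : n < 128 * 2 ^ (a + 1) * (2 * (a + 1) + 200) := by
    by_contra! h
    have h1 : a + 1 < 2 ^ (a + 1) := Nat.lt_two_pow_self
    have h2 : a + 1 ≤ n := by nlinarith
    have h3 : a + 1 ≤ a := Nat.le_findGreatest (P := P) h2 h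
    omega
  have hpos : 0 < 128 * 2 ^ a := by positivity
  have hQ : 2 * a + 200 ≤ n / (128 * 2 ^ a) := by
    rw [Nat.le_div_iff_mul_le hpos]
    linarith
  have hQ' : n / (128 * 2 ^ a) < 4 * a + 404 := by
    rw [Nat.div_lt_iff_lt_mul hpos]
    calc n < 128 * 2 ^ (a + 1) * (2 * (a + 1) + 200) := hPa'
      _ = (4 * a + 404) * (128 * 2 ^ a) := by ring
  refine ⟨a, n / (128 * 2 ^ a), 2 ^ (a - 6), ?_, hQ, Nat.mul_div_le _ _,
    Nat.lt_mul_div_succ _ hpos, by omega, by nlinarith⟩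
  rw [show (64 : ℕ) = 2 ^ 6 by norm_num, ← pow_add, Nat.add_sub_cancel' h6]

/-- A depth that is quadratic in the number of levels of the butterfly is polylogarithmic. -/
theorem depth_le_log_pow_three {n a Q D : ℕ} (hn : 3 ≤ n) (hQ : Q + 1 ≤ 72 * a) (ha : 2 ^ a ≤ n)
    (hD : D ≤ 2 * (256 * (Q + 1)) ^ 2 + 4 * a) :
    (D : ℝ) ≤ 10 ^ 10 * Real.log n ^ 3 := by
  have hn0 : (0 : ℝ) < n := by positivity
  have hlog1 : 1 ≤ Real.log n := by
    rw [Real.le_log_iff_exp_le hn0]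
    exact Real.exp_one_lt_three.le.trans (by exact_mod_cast hn)
  have halog : (a : ℝ) ≤ 2 * Real.log n := by
    have h1 : (a : ℝ) * Real.log 2 ≤ Real.log n := by
      rw [← Real.log_pow]
      exact Real.log_le_log (by positivity) (by exact_mod_cast ha)
    have h2 := Real.log_two_gt_d9
    have h3 : (0 : ℝ) ≤ a := Nat.cast_nonneg a
    nlinarith
  have hD' : D ≤ 2 * (256 * (72 * a)) ^ 2 + 4 * a ^ 2 := by
    refine hD.trans ?_
    have h1 : a ≤ a ^ 2 := Nat.le_self_pow two_ne_zero a
    gcongr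
  have hDr : (D : ℝ) ≤ 2 * (256 * (72 * a)) ^ 2 + 4 * a ^ 2 := by exact_mod_cast hD'
  have ha2 : (a : ℝ) ^ 2 ≤ 4 * Real.log n ^ 2 := by
    calc (a : ℝ) ^ 2 ≤ (2 * Real.log n) ^ 2 := by gcongr
      _ = 4 * Real.log n ^ 2 := by ring
  have hlog3 : Real.log n ^ 2 ≤ Real.log n ^ 3 := pow_le_pow_right₀ hlog1 (by norm_num)
  calc (D : ℝ) ≤ 2 * (256 * (72 * a)) ^ 2 + 4 * a ^ 2 := hDr
    _ = (2 * (256 * 72) ^ 2 + 4) * (a : ℝ) ^ 2 := by ring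
    _ ≤ (2 * (256 * 72) ^ 2 + 4) * (4 * Real.log n ^ 2) := by gcongr
    _ ≤ 10 ^ 10 * Real.log n ^ 3 := by nlinarith

theorem mainTheorem2 :
    ∃ α β c : ℝ, 0 < α ∧ 0 < β ∧ 0 < c ∧ ∃ n₀ : ℕ, ∀ n : ℕ, n₀ ≤ n →
      ∃ (C : StabilizerCode n) (E : CliffordCircuit n),
        C.EncodesQubits ⌊β * (n : ℝ)⌋₊ ∧
        C.IsNondegenerate ∧
        α * (n : ℝ) ≤ (C.minDistance : ℝ) ∧
        E.IsEncoder C ⌊β * (n : ℝ)⌋₊ ∧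
        (E.depth : ℝ) ≤ c * (Real.log (n : ℝ)) ^ 3 := by
  refine ⟨1 / 2000, 15 / 16, 10 ^ 10, by norm_num, by norm_num, by norm_num, 128 * 2 ^ 6 * 212,
    fun n hn => ?_⟩
  obtain ⟨a, Q, M, hM, hQ, hlow, hupp, hQa, han⟩ := exists_params hn
  obtain ⟨C, E, hk, hnd, hd, hE, hD⟩ := exists_code_of_params hM hQ hlow hupp
  have hfloor : ⌊15 / 16 * (n : ℝ)⌋₊ = 15 * n / 16 := by
    rw [show 15 / 16 * (n : ℝ) = ((15 * n : ℕ) : ℝ) / ((16 : ℕ) : ℝ) by push_cast; ring]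
    exact Nat.floor_div_eq_div _ _
  rw [hfloor]
  refine ⟨C, E, hk, hnd, ?_, hE, depth_le_log_pow_three (by omega) hQa han hD⟩
  have h1 : n ≤ 2000 * C.minDistance := by omega
  have h2 : (n : ℝ) ≤ 2000 * C.minDistance := by exact_mod_cast h1
  linarith
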